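/- Let $d,N\ge 1$ be integers, let $p\in(1,\infty)$, let $\Omega\subset\mathbb R^d$ be a non-empty, bounded, open set, and let $\Phi\colon\mathbb R^N_+\to[0,\infty)$ be any function, where $\mathbb R^N_+=[0,\infty)^N$. Sets are Lebesgue measurable, $|\cdot|$ is Lebesgue measure, and set inclusions are meant up to null sets. We set $\Phi(v)=\infty$ if $v\in[0,\infty]^N$ has an infinite component. For a set $F\subset\mathbb R^d$, let $W^{1,p}_0(F)=\{u\in W^{1,p}(\mathbb R^d): u=0\text{ a.e. on }\mathbb R^d\setminus F\}$ and $$\lambda_{1,p}(F)=\inf\Big\{\int_F|\nabla u|^p\,dx : u\in W^{1,p}_0(F),\ \|u\|_{L^p}=1\Big\}\in[0,\infty].$$ An $N$-set of $\Omega$ is an $N$-tuple $\mathcal E=(\mathcal E_1,\dots,\mathcal E_N)$ of sets $\mathcal E_i\subset\Omega$ with $|\mathcal E_i|>0$ and $|\mathcal E_i\cap\mathcal E_j|=0$ for $i\ne j$. A $(p,N)$-function of $\Omega$ is an $N$-tuple $u=(u_1,\dots,u_N)$ of functions $u_i\in W^{1,p}_0(\Omega)$ with $u_i\ge 0$, $\|u_i\|_{L^p}=1$,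 and $u_iu_j=0$ a.e. in $\Omega$ for $i\neq j$. Define $$\mathscr L^{\Phi,N}_{1,p}(\Omega)=\inf\big\{\Phi(\lambda_{1,p}(\mathcal E_1),\dots,\lambda_{1,p}(\mathcal E_N)) : \mathcal E \text{ is an } N\text{-set of }\Omega\big\},$$ $$\Lambda^{\Phi,N}_{1,p}(\Omega)=\inf\big\{\Phi(\|\nabla u_1\|_{L^p}^p,\dots,\|\nabla u_N\|_{L^p}^p) : u \text{ is a } (p,N)\text{-function of }\Omega\big\}.$$ A $(p,\Phi)$-eigen-$N$-set of $\Omega$ is an $N$-set attaining the first infimum, and a $(p,\Phi)$-eigen-$N$-function of $\Omega$ is a $(p,N)$-function attaining the second. **Theorem.** One has $\mathscr L^{\Phi,N}_{1,p}(\Omega)\ge\Lambda^{\Phi,N}_{1,p}(\Omega)$. If moreover $\Phi$ is increasing, i.e. $\Phi(v)\le\Phi(w)$ whenever $v,w\in\mathbb R^N_+$ satisfy $v_i\le w_i$ for all $i$, then: 1. $\mathscr L^{\Phi,N}_{1,p}(\Omega)=\Lambda^{\Phi,N}_{1,p}(\Omega)$; 2. if $u$ is a $(p,\Phi)$-eigen-$N$-function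 of $\Omega$, then $(\{u_1>0\},\dots,\{u_N>0\})$ is a $(p,\Phi)$-eigen-$N$-set of $\Omega$; 3. conversely, if $\mathcal E$ is a $(p,\Phi)$-eigen-$N$-set of $\Omega$, there exists a $(p,\Phi)$-eigen-$N$-function $u$ of $\Omega$ such that $\{u_i>0\}\subset\mathcal E_i$ for all $i=1,\dots,N$. -/

import Mathlib

open MeasureTheory
open scoped NNReal ENNReal ContDiff

namespace NPartition

/-- `g` is the weak (distributional) gradient of `u` on `ℝ^d`: both are locally integrable and
`∫ u ∂_v φ = - ∫ ⟨g, v⟩ φ` for all test functions `φ ∈ C_c^∞(ℝ^d)` and all directions `v`. -/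
structure HasWeakGradient {d : ℕ} (u : EuclideanSpace ℝ (Fin d) → ℝ)
    (g : EuclideanSpace ℝ (Fin d) → EuclideanSpace ℝ (Fin d)) : Prop where
  locallyIntegrable : LocallyIntegrable u volume
  locallyIntegrable_grad : LocallyIntegrable g volume
  integral_eq : ∀ φ : EuclideanSpace ℝ (Fin d) → ℝ, ContDiff ℝ ∞ φ → HasCompactSupport φ →
    ∀ v : EuclideanSpace ℝ (Fin d),
      ∫ x, u x * fderiv ℝ φ x v = - ∫ x, inner ℝ (g x) v * φ x

open Classical in
/-- The weak gradient `∇u` (unique up to a null set if it exists; `0` if there is none). -/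
noncomputable def weakGrad {d : ℕ} (u : EuclideanSpace ℝ (Fin d) → ℝ) :
    EuclideanSpace ℝ (Fin d) → EuclideanSpace ℝ (Fin d) :=
  if h : ∃ g, HasWeakGradient u g then h.choose else 0

/-- `u ∈ W^{1,p}(ℝ^d)`. -/
def MemW1p {d : ℕ} (p : ℝ) (u : EuclideanSpace ℝ (Fin d) → ℝ) : Prop :=
  MemLp u (ENNReal.ofReal p) volume ∧
    ∃ g, HasWeakGradient u g ∧ MemLp g (ENNReal.ofReal p) volume

/-- `u ∈ W^{1,p}_0(F)`: `u ∈ W^{1,p}(ℝ^d)` and `u = 0` a.e. on `ℝ^d ∖ F`. -/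
def MemW1p0 {d : ℕ} (p : ℝ) (F : Set (EuclideanSpace ℝ (Fin d)))
    (u : EuclideanSpace ℝ (Fin d) → ℝ) : Prop :=
  MemW1p p u ∧ ∀ᵐ x ∂volume, x ∉ F → u x = 0

/-- The first `p`-eigenvalue
`λ_{1,p}(F) = inf {∫_F |∇u|^p : u ∈ W^{1,p}_0(F), ‖u‖_p = 1} ∈ [0, ∞]`. -/
noncomputable def firstEigenvalue {d : ℕ} (p : ℝ) (F : Set (EuclideanSpace ℝ (Fin d))) : ℝ≥0∞ :=
  ⨅ (u : EuclideanSpace ℝ (Fin d) → ℝ) (_ : MemW1p0 p F u)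
    (_ : eLpNorm u (ENNReal.ofReal p) volume = 1),
      ∫⁻ x in F, ‖weakGrad u x‖ₑ ^ p

/-- The vector `(‖∇u_1‖_p^p, …, ‖∇u_N‖_p^p)` of the `p`-th powers of the `L^p(ℝ^d)` norms of the
gradients. -/
noncomputable def gradEnergy {d N : ℕ} (p : ℝ) (u : Fin N → EuclideanSpace ℝ (Fin d) → ℝ) :
    Fin N → ℝ≥0∞ :=
  fun i => ∫⁻ x, ‖weakGrad (u i) x‖ₑ ^ p

open Classical in
/-- A reference function `Φ : ℝ^N_+ → [0, ∞)`, evaluated at a vector with entries in `[0, ∞]`: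
the value is `∞` if some entry is infinite. -/
noncomputable def evalRef {N : ℕ} (Φ : (Fin N → ℝ≥0) → ℝ≥0) (v : Fin N → ℝ≥0∞) : ℝ≥0∞ :=
  if ∀ i, v i ≠ ⊤ then (Φ (fun i => (v i).toNNReal) : ℝ≥0∞) else ⊤

/-- `N`-sets of `F`; chambers are Lebesgue measurable, and inclusion and disjointness are meant up
to null sets. -/
structure IsNSet {d N : ℕ} (F : Set (EuclideanSpace ℝ (Fin d)))
    (E : Fin N → Set (EuclideanSpace ℝ (Fin d))) : Prop where
  measurable : ∀ i, NullMeasurableSet (E i) volume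
  subset : ∀ i, volume (E i \ F) = 0
  pos : ∀ i, 0 < volume (E i)
  disjoint : ∀ i j, i ≠ j → volume (E i ∩ E j) = 0

/-- `(p,N)`-functions of `F`. -/
structure IsPNFunction {d N : ℕ} (p : ℝ) (F : Set (EuclideanSpace ℝ (Fin d)))
    (u : Fin N → EuclideanSpace ℝ (Fin d) → ℝ) : Prop where
  mem : ∀ i, MemW1p0 p F (u i)
  nonneg : ∀ i, ∀ᵐ x ∂volume, 0 ≤ u i x
  norm_eq_one : ∀ i, eLpNorm (u i) (ENNReal.ofReal p) volume = 1
  disjoint : ∀ i j, i ≠ j → ∀ᵐ x ∂volume, x ∈ F → u i x * u j x = 0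

/-- The first `p`-geometric `(Φ,N)`-eigenvalue `𝓛^{Φ,N}_{1,p}(F)`. -/
noncomputable def geomEigenvalue {d N : ℕ} (p : ℝ) (Φ : (Fin N → ℝ≥0) → ℝ≥0)
    (F : Set (EuclideanSpace ℝ (Fin d))) : ℝ≥0∞ :=
  ⨅ (E : Fin N → Set (EuclideanSpace ℝ (Fin d))) (_ : IsNSet F E),
    evalRef Φ (fun i => firstEigenvalue p (E i))

/-- The first `p`-functional `(Φ,N)`-eigenvalue `Λ^{Φ,N}_{1,p}(F)`. -/
noncomputable def funEigenvalue {d N : ℕ} (p : ℝ) (Φ : (Fin N → ℝ≥0) → ℝ≥0)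
    (F : Set (EuclideanSpace ℝ (Fin d))) : ℝ≥0∞ :=
  ⨅ (u : Fin N → EuclideanSpace ℝ (Fin d) → ℝ) (_ : IsPNFunction p F u),
    evalRef Φ (gradEnergy p u)

/-- `(p,Φ)`-eigen-`N`-sets of `F`: `N`-sets achieving the infimum `𝓛^{Φ,N}_{1,p}(F)`. -/
def IsEigenNSet {d N : ℕ} (p : ℝ) (Φ : (Fin N → ℝ≥0) → ℝ≥0)
    (F : Set (EuclideanSpace ℝ (Fin d))) (E : Fin N → Set (EuclideanSpace ℝ (Fin d))) : Prop :=
  IsNSet F E ∧ evalRef Φ (fun i => firstEigenvalue p (E i)) = geomEigenvalue p Φ F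

/-- `(p,Φ)`-eigen-`N`-functions of `F`: `(p,N)`-functions achieving `Λ^{Φ,N}_{1,p}(F)`. -/
def IsEigenNFunction {d N : ℕ} (p : ℝ) (Φ : (Fin N → ℝ≥0) → ℝ≥0)
    (F : Set (EuclideanSpace ℝ (Fin d))) (u : Fin N → EuclideanSpace ℝ (Fin d) → ℝ) : Prop :=
  IsPNFunction p F u ∧ evalRef Φ (gradEnergy p u) = funEigenvalue p Φ F

end NPartition

/-! Two comparisons give everything. A $(p,N)$-function $u$ yields the $N$-set of its positivity
sets, and each $u_i$ competes for the eigenvalue of its own positivity set, so the eigenvalues are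
at most the gradient energies (`IsPNFunction.isNSet`, `IsPNFunction.firstEigenvalue_le_gradEnergy`).
Since this is only an inequality, monotonicity of $\Phi$ is needed to exploit it. Conversely, if all
chambers of an $N$-set have finite eigenvalue, nonnegative first eigenfunctions of the chambers form
a $(p,N)$-function whose energies equal the eigenvalues (`IsNSet.exists_isPNFunction`); this
direction works for every $\Phi$. For the third claim one also needs the common infimum to be
finite, so that the chambers of an eigen-$N$-set have finite eigenvalues; disjoint bumps in $\Omega$
show this (`funEigenvalue_ne_top`).

The analytic content is the existence of a nonnegative first eigenfunction on an essentially bounded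
measurable set (`exists_firstEigenfunction`), by the direct method with strong convergence
throughout. A weak gradient controls translations, so a minimizing sequence is totally bounded in
$L^p$ (`totallyBounded_of_norm_translate_sub_le`). Along a convergent subsequence, midpoints of
pairs have nearly norm one, hence nearly minimal energy at least; uniform convexity then makes the
gradients Cauchy (`cauchySeq_of_norm_midpoint`), and the limit is a minimizer (`exists_minimizer`).

Replacing the minimizer by its absolute value keeps the energy because
$\nabla|u|=\operatorname{sign}(u)\nabla u$ and $\nabla u=0$ a.e. on $\{u=0\}$. Both facts come from
comparing the two one-sided derivatives of $t\mapsto\int|u+t\,\partial_v u|\varphi$ at $0$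
(`integral_abs_mul_fderiv`). -/

namespace NPartition

open Filter Topology

variable {d : ℕ} {q : ℝ≥0∞}

/-! ### Translations in $L^q$ and weak directional derivatives -/

section Translation

variable {F : Type*} [NormedAddCommGroup F]

/-- The translate `x ↦ f (x + v)` of an `L^q` function. -/
noncomputable def translate (v : EuclideanSpace ℝ (Fin d))
    (f : Lp F q (volume : Measure (EuclideanSpace ℝ (Fin d)))) :
    Lp F q (volume : Measure (EuclideanSpace ℝ (Fin d))) :=
  Lp.compMeasurePreserving (fun x => x + v) (measurePreserving_add_right volume v) f

theorem coeFn_translate (v : EuclideanSpace ℝ (Fin d))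
    (f : Lp F q (volume : Measure (EuclideanSpace ℝ (Fin d)))) :
    translate v f =ᵐ[volume] fun x => f (x + v) :=
  Lp.coeFn_compMeasurePreserving f (measurePreserving_add_right volume v)

theorem norm_translate (v : EuclideanSpace ℝ (Fin d))
    (f : Lp F q (volume : Measure (EuclideanSpace ℝ (Fin d)))) :
    ‖translate v f‖ = ‖f‖ :=
  Lp.norm_compMeasurePreserving f (measurePreserving_add_right volume v)

theorem translate_zero (f : Lp F q (volume : Measure (EuclideanSpace ℝ (Fin d)))) :
    translate 0 f = f := by
  apply Lp.ext
  filter_upwards [coeFn_translate 0 f] with x hx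
  simpa using hx

theorem continuous_translate [Fact (1 ≤ q)] (hq : q ≠ ⊤)
    (f : Lp F q (volume : Measure (EuclideanSpace ℝ (Fin d)))) :
    Continuous fun v => translate v f := by
  let g : C(EuclideanSpace ℝ (Fin d), C(EuclideanSpace ℝ (Fin d), EuclideanSpace ℝ (Fin d))) :=
    (ContinuousMap.mk (fun a : EuclideanSpace ℝ (Fin d) × EuclideanSpace ℝ (Fin d) => a.2 + a.1)
      (by fun_prop)).curry
  exact (continuous_const (y := f)).compMeasurePreservingLp g.continuous
    (fun v => measurePreserving_add_right volume v) hq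

theorem hasDerivAt_integral_mul_comp_sub {f φ : EuclideanSpace ℝ (Fin d) → ℝ}
    (hf : LocallyIntegrable f volume) (hφ : ContDiff ℝ ∞ φ) (hφc : HasCompactSupport φ)
    (v : EuclideanSpace ℝ (Fin d)) (t : ℝ) :
    HasDerivAt (fun t : ℝ => ∫ x, f x * φ (x - t • v))
      (-∫ x, f x * fderiv ℝ φ (x - t • v) v) t := by
  -- Reflecting the test function turns the integral into the convolution of `f` and `ψ` at `t • v`,
  -- which may be differentiated on the smooth factor.
  set ψ : EuclideanSpace ℝ (Fin d) → ℝ := fun y => φ (-y) with hψ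
  have hψd : ContDiff ℝ ∞ ψ := hφ.comp contDiff_neg
  have hψc : HasCompactSupport ψ := hφc.comp_homeomorph (Homeomorph.neg _)
  have hψ1 : ContDiff ℝ 1 ψ := hψd.of_le (by simp)
  have h1 := hψc.hasFDerivAt_convolution_right (ContinuousLinearMap.mul ℝ ℝ) hf hψ1 (t • v)
  have h2 : HasDerivAt (fun t : ℝ => t • v) v t := by
    simpa using (hasDerivAt_id t).smul_const v
  have h3 := h1.comp_hasDerivAt t h2
  have e : (convolution f (fderiv ℝ ψ)
      (ContinuousLinearMap.precompR (EuclideanSpace ℝ (Fin d)) (ContinuousLinearMap.mul ℝ ℝ))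
        volume (t • v)) v = -∫ x, f x * fderiv ℝ φ (x - t • v) v := by
    rw [convolution_precompR_apply (ContinuousLinearMap.mul ℝ ℝ) hf (hψc.fderiv ℝ)
      (hψ1.continuous_fderiv one_ne_zero)]
    rw [convolution_def, ← integral_neg]
    congr 1
    ext x
    have : fderiv ℝ ψ (t • v - x) v = - fderiv ℝ φ (x - t • v) v := by
      have hd : HasFDerivAt ψ
          ((fderiv ℝ φ (x - t • v)).comp (-ContinuousLinearMap.id ℝ _)) (t • v - x) := by
        have h4 : HasFDerivAt φ (fderiv ℝ φ (x - t • v)) (-(t • v - x)) := by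
          rw [neg_sub]
          exact (hφ.differentiable (by simp) _).hasFDerivAt
        exact h4.comp _ (hasFDerivAt_id _).neg
      rw [hd.fderiv]; simp
    simp [this]
  rw [e] at h3
  convert! h3 using 1
  ext s
  simp only [Function.comp, convolution_def, hψ, ContinuousLinearMap.mul_apply', neg_sub]

theorem memLp_of_continuous {φ : EuclideanSpace ℝ (Fin d) → ℝ}
    (hφ : Continuous φ) (hφc : HasCompactSupport φ) (r : ℝ≥0∞) : MemLp φ r volume :=
  hφ.memLp_of_hasCompactSupport hφc

theorem exists_pairing [Fact (1 ≤ q)] {φ : EuclideanSpace ℝ (Fin d) → ℝ}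
    (hφ : Continuous φ) (hφc : HasCompactSupport φ) :
    ∃ T : Lp ℝ q (volume : Measure (EuclideanSpace ℝ (Fin d))) →L[ℝ] ℝ,
      ∀ f, T f = ∫ x, f x * φ x := by
  have hq : ENNReal.HolderConjugate q (ENNReal.conjExponent q) :=
    ENNReal.HolderConjugate.conjExponent Fact.out
  have : Fact (1 ≤ ENNReal.conjExponent q) := ⟨hq.symm.one_le⟩
  have hm := memLp_of_continuous hφ hφc (ENNReal.conjExponent q)
  refine ⟨((ContinuousLinearMap.mul ℝ ℝ).lpPairing volume q (ENNReal.conjExponent q)).flip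
    (hm.toLp φ), fun f => ?_⟩
  rw [ContinuousLinearMap.flip_apply, ContinuousLinearMap.lpPairing_eq_integral]
  apply integral_congr_ae
  filter_upwards [hm.coeFn_toLp] with x hx
  simp [hx]

theorem integral_translate_mul
    (f : Lp ℝ q (volume : Measure (EuclideanSpace ℝ (Fin d)))) (φ : EuclideanSpace ℝ (Fin d) → ℝ)
    (v : EuclideanSpace ℝ (Fin d)) :
    ∫ x, translate v f x * φ x = ∫ x, f x * φ (x - v) := by
  rw [← integral_add_right_eq_self (fun x => f x * φ (x - v)) v]
  apply integral_congr_ae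
  filter_upwards [coeFn_translate v f] with x hx
  simp [hx]

theorem locallyIntegrable_Lp [Fact (1 ≤ q)]
    (f : Lp F q (volume : Measure (EuclideanSpace ℝ (Fin d)))) :
    LocallyIntegrable f volume :=
  (Lp.memLp f).locallyIntegrable Fact.out

theorem Lp_eq_zero_of_pairing [Fact (1 ≤ q)]
    (f : Lp ℝ q (volume : Measure (EuclideanSpace ℝ (Fin d))))
    (h : ∀ φ : EuclideanSpace ℝ (Fin d) → ℝ, ContDiff ℝ ∞ φ → HasCompactSupport φ →
      ∫ x, f x * φ x = 0) : f = 0 := by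
  apply Lp.ext
  filter_upwards [ae_eq_zero_of_integral_contDiff_smul_eq_zero (locallyIntegrable_Lp f)
    (fun φ h1 h2 => by simpa [mul_comm] using h φ h1 h2), Lp.coeFn_zero ℝ q volume] with x hx h0
  rw [hx, h0]; rfl

/-- The fundamental theorem of calculus along a line, as a Bochner integral in $L^q$. Paired with a
test function, the translate of `U` is differentiable with derivative the pairing of the translate
of `H`, and test functions separate $L^q$. Continuity of translations is where `q ≠ ⊤` enters. -/
theorem translate_sub_eq_integral [Fact (1 ≤ q)] (hq : q ≠ ⊤)
    (U H : Lp ℝ q (volume : Measure (EuclideanSpace ℝ (Fin d)))) (v : EuclideanSpace ℝ (Fin d))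
    (hUH : ∀ φ : EuclideanSpace ℝ (Fin d) → ℝ, ContDiff ℝ ∞ φ → HasCompactSupport φ →
      ∫ x, U x * fderiv ℝ φ x v = - ∫ x, H x * φ x) (t : ℝ) :
    translate (t • v) U - U = ∫ s in (0 : ℝ)..t, translate (s • v) H := by
  have hcont : Continuous fun s : ℝ => translate (s • v) H :=
    (continuous_translate hq H).comp (by fun_prop)
  rw [← sub_eq_zero]
  apply Lp_eq_zero_of_pairing
  intro φ hφ hφc
  obtain ⟨T, hT⟩ := exists_pairing (q := q) hφ.continuous hφc
  rw [← hT, map_sub, map_sub, ← T.intervalIntegral_comp_comm (hcont.intervalIntegrable _ _),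
    sub_eq_zero]
  have hd : ∀ s : ℝ,
      HasDerivAt (fun t : ℝ => T (translate (t • v) U)) (T (translate (s • v) H)) s := by
    intro s
    have h1 := hasDerivAt_integral_mul_comp_sub (locallyIntegrable_Lp U) hφ hφc v s
    simp only [hT, integral_translate_mul]
    convert! h1 using 1
    have h2 := hUH (fun x => φ (x - s • v)) (hφ.comp (contDiff_id.sub contDiff_const))
      (hφc.comp_homeomorph (Homeomorph.subRight (s • v)))
    simp only [fderiv_comp_sub] at h2
    rw [h2, neg_neg]
  rw [intervalIntegral.integral_eq_sub_of_hasDerivAt (fun s _ => hd s)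
    ((T.continuous.comp hcont).intervalIntegrable _ _)]
  simp [translate_zero]

theorem norm_translate_sub_le [Fact (1 ≤ q)] (hq : q ≠ ⊤)
    (U H : Lp ℝ q (volume : Measure (EuclideanSpace ℝ (Fin d)))) (v : EuclideanSpace ℝ (Fin d))
    (hUH : ∀ φ : EuclideanSpace ℝ (Fin d) → ℝ, ContDiff ℝ ∞ φ → HasCompactSupport φ →
      ∫ x, U x * fderiv ℝ φ x v = - ∫ x, H x * φ x) :
    ‖translate v U - U‖ ≤ ‖H‖ := by
  have h := translate_sub_eq_integral hq U H v hUH 1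
  rw [one_smul] at h
  rw [h]
  simpa using intervalIntegral.norm_integral_le_of_norm_le_const (a := 0) (b := 1) (C := ‖H‖)
    (f := fun s : ℝ => translate (s • v) H) (fun s _ => (norm_translate _ _).le)

theorem hasDerivAt_translate [Fact (1 ≤ q)] (hq : q ≠ ⊤)
    (U H : Lp ℝ q (volume : Measure (EuclideanSpace ℝ (Fin d)))) (v : EuclideanSpace ℝ (Fin d))
    (hUH : ∀ φ : EuclideanSpace ℝ (Fin d) → ℝ, ContDiff ℝ ∞ φ → HasCompactSupport φ →
      ∫ x, U x * fderiv ℝ φ x v = - ∫ x, H x * φ x) :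
    HasDerivAt (fun t : ℝ => translate (t • v) U) H 0 := by
  have hcont : Continuous fun s : ℝ => translate (s • v) H :=
    (continuous_translate hq H).comp (by fun_prop)
  have h := (intervalIntegral.integral_hasDerivAt_right (hcont.intervalIntegrable 0 0)
    hcont.aestronglyMeasurable.stronglyMeasurableAtFilter hcont.continuousAt).add_const U
  simp only [zero_smul, translate_zero] at h
  refine h.congr_of_eventuallyEq (Eventually.of_forall fun t => ?_)
  simp only [← translate_sub_eq_integral hq U H v hUH t, sub_add_cancel]

end Translation

/-! ### The weak derivative of the absolute value -/

theorem tendsto_abs_add_mul_sub_div (a b : ℝ) :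
    Tendsto (fun t : ℝ => (|a + t * b| - |a|) / t) (𝓝[>] 0)
      (𝓝 (SignType.sign a * b + if a = 0 then |b| else 0)) := by
  have hlim : Tendsto (fun t : ℝ => a + t * b) (𝓝[>] 0) (𝓝 a) := by
    have : ContinuousAt (fun t : ℝ => a + t * b) 0 := by fun_prop
    simpa using (this.tendsto).mono_left nhdsWithin_le_nhds
  apply tendsto_const_nhds.congr'
  rcases lt_trichotomy a 0 with ha | ha | ha
  · filter_upwards [hlim.eventually (gt_mem_nhds ha), self_mem_nhdsWithin] with t ht h0
    have h0 : t ≠ 0 := ne_of_gt h0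
    rw [abs_of_neg ht, abs_of_neg ha, sign_neg ha, if_neg ha.ne]
    simp; field_simp
  · filter_upwards [self_mem_nhdsWithin] with t h0
    have h0 : 0 < t := h0
    subst ha
    simp [abs_mul, abs_of_pos h0]; field_simp
  · filter_upwards [hlim.eventually (lt_mem_nhds ha), self_mem_nhdsWithin] with t ht h0
    have h0 : t ≠ 0 := ne_of_gt h0
    rw [abs_of_pos ht, abs_of_pos ha, sign_pos ha, if_neg ha.ne']
    simp; field_simp

theorem Lp_integrable_mul [Fact (1 ≤ q)]
    (f : Lp ℝ q (volume : Measure (EuclideanSpace ℝ (Fin d))))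
    {φ : EuclideanSpace ℝ (Fin d) → ℝ} (hφ : Continuous φ) (hφc : HasCompactSupport φ) :
    Integrable (fun x => f x * φ x) volume := by
  simpa [mul_comm] using
    (locallyIntegrable_Lp f).integrable_smul_left_of_hasCompactSupport hφ hφc

theorem aestronglyMeasurable_sign_mul {α : Type*} [MeasurableSpace α] {μ : Measure α}
    {u h : α → ℝ} (hu : AEStronglyMeasurable u μ) (hh : AEStronglyMeasurable h μ) :
    AEStronglyMeasurable (fun x => (SignType.sign (u x) : ℝ) * h x) μ := by
  refine AEStronglyMeasurable.mul ?_ hh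
  have : Measurable (fun t : ℝ => (SignType.sign t : ℝ)) := by
    have e : (fun t : ℝ => (SignType.sign t : ℝ)) =
        fun t => if 0 < t then 1 else if t < 0 then -1 else 0 := by
      ext t
      rw [sign_apply]; split_ifs <;> simp
    rw [e]
    exact Measurable.ite measurableSet_Ioi measurable_const
      (Measurable.ite measurableSet_Iio measurable_const measurable_const)
  exact (this.comp_aemeasurable hu.aemeasurable).aestronglyMeasurable

theorem abs_sign_mul_le (a b : ℝ) : |(SignType.sign a : ℝ) * b| ≤ |b| := by
  rcases lt_trichotomy a 0 with ha | ha | ha <;> simp [ha, sign_neg, sign_pos]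

/-- Dominated convergence: the absolute value is 1-Lipschitz, so the difference quotients are
bounded by `‖H x * φ x‖`. -/
theorem tendsto_slope_integral_abs [Fact (1 ≤ q)]
    (U H : Lp ℝ q (volume : Measure (EuclideanSpace ℝ (Fin d))))
    {φ : EuclideanSpace ℝ (Fin d) → ℝ} (hφ : Continuous φ) (hφc : HasCompactSupport φ) :
    Tendsto (fun t : ℝ => ((∫ x, |U x + t * H x| * φ x) - ∫ x, |U x| * φ x) / t) (𝓝[>] 0)
      (𝓝 (∫ x, (SignType.sign (U x) * H x + if U x = 0 then |H x| else 0) * φ x)) := by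
  have hU := Lp.aestronglyMeasurable U
  have hH := Lp.aestronglyMeasurable H
  have hφm : AEStronglyMeasurable φ volume := hφ.aestronglyMeasurable
  have key : ∀ t : ℝ, ((∫ x, |U x + t * H x| * φ x) - ∫ x, |U x| * φ x) / t =
      ∫ x, ((|U x + t * H x| - |U x|) / t) * φ x := by
    intro t
    rw [← integral_sub, div_eq_inv_mul, ← integral_const_mul]
    · congr 1; ext x; ring
    · have := ((Lp_integrable_mul U hφ hφc).add ((Lp_integrable_mul H hφ hφc).const_mul t)).norm
      refine this.mono ((hU.add (hH.const_mul t)).norm.mul hφm) (Eventually.of_forall fun x => ?_)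
      simp only [Pi.add_apply, norm_mul, Real.norm_eq_abs, abs_abs]
      rw [← abs_mul]
      apply le_of_eq; congr 1; ring
    · refine (Lp_integrable_mul U hφ hφc).norm.mono (hU.norm.mul hφm)
        (Eventually.of_forall fun x => ?_)
      simp
  simp only [key]
  refine tendsto_integral_filter_of_dominated_convergence (fun x => ‖H x * φ x‖) ?_ ?_ ?_ ?_
  · exact Eventually.of_forall fun t =>
      ((((hU.add (hH.const_mul t)).norm.sub hU.norm).mul_const t⁻¹).mul hφm)
  · filter_upwards [self_mem_nhdsWithin] with t ht
    have ht : 0 < t := ht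
    refine Eventually.of_forall fun x => ?_
    rw [norm_mul, norm_mul]
    gcongr
    rw [norm_div, Real.norm_eq_abs t, abs_of_pos ht, div_le_iff₀ ht]
    refine (abs_abs_sub_abs_le_abs_sub _ _).trans ?_
    rw [add_sub_cancel_left, abs_mul, abs_of_pos ht, mul_comm, Real.norm_eq_abs]
  · exact (Lp_integrable_mul H hφ hφc).norm
  · exact Eventually.of_forall fun x => (tendsto_abs_add_mul_sub_div _ _).mul_const _

theorem exists_abs_integral_abs_sub_abs_le [Fact (1 ≤ q)]
    {φ : EuclideanSpace ℝ (Fin d) → ℝ} (hφ : Continuous φ) (hφc : HasCompactSupport φ) :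
    ∃ C : ℝ, ∀ f g : Lp ℝ q (volume : Measure (EuclideanSpace ℝ (Fin d))),
      |(∫ x, |f x| * φ x) - ∫ x, |g x| * φ x| ≤ C * ‖f - g‖ := by
  obtain ⟨T, hT⟩ := exists_pairing (q := q) hφ.abs hφc.abs
  refine ⟨‖T‖, fun f g => ?_⟩
  have hi : ∀ f : Lp ℝ q (volume : Measure (EuclideanSpace ℝ (Fin d))),
      Integrable (fun x => |f x| * φ x) volume := fun f =>
    (Lp_integrable_mul f hφ hφc).norm.mono
      ((Lp.aestronglyMeasurable f).norm.mul hφ.aestronglyMeasurable)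
      (Eventually.of_forall fun x => by simp)
  rw [← integral_sub (hi f) (hi g)]
  calc |∫ x, (|f x| * φ x - |g x| * φ x)| ≤ ∫ x, |(f - g) x * φ x| := by
        refine (abs_integral_le_integral_abs).trans (integral_mono_ae ((hi f).sub (hi g)).abs
          (Lp_integrable_mul (f - g) hφ hφc).abs ?_)
        filter_upwards [Lp.coeFn_sub f g] with x hx
        simp only [hx, Pi.sub_apply]
        rw [← sub_mul, abs_mul, abs_mul]
        exact mul_le_mul_of_nonneg_right (abs_abs_sub_abs_le_abs_sub _ _) (abs_nonneg _)
    _ = T |f - g| := by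
        rw [hT]
        apply integral_congr_ae
        filter_upwards [Lp.coeFn_abs (f - g)] with x hx
        rw [hx, abs_mul]
    _ ≤ ‖T‖ * ‖f - g‖ := by
        refine (le_abs_self _).trans ((T.le_opNorm _).trans_eq ?_)
        rw [norm_abs_eq_norm]

theorem tendsto_slope_comp_mul {f : ℝ → ℝ} {f' : ℝ} (hf : HasDerivAt f f' 0) (c : ℝ) :
    Tendsto (fun t : ℝ => (f (c * t) - f 0) / t) (𝓝[>] 0) (𝓝 (c * f')) := by
  have h1 : HasDerivAt (fun t => f (c * t)) (f' * c) 0 := by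
    have h2 : HasDerivAt (fun t : ℝ => c * t) c 0 := by
      simpa using (hasDerivAt_id (0 : ℝ)).const_mul c
    have h3 : HasDerivAt f f' (c * 0) := by simpa using hf
    exact h3.comp 0 h2
  have h4 := (hasDerivAt_iff_tendsto_slope.1 h1).mono_left
    (nhdsWithin_mono _ (s := Set.Ioi 0) (t := {0}ᶜ) (fun t ht => (ne_of_gt ht)))
  rw [mul_comm]
  refine h4.congr fun t => ?_
  simp [slope_def_field]

/-- In $L^q$ the translate of `U` by `t • v` is `U + t • H` up to $o(t)$, so
$t\mapsto\int|U+tH|\varphi$ has the two-sided derivative $-\int|U|\partial_v\varphi$ at $0$. Its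
right and left derivatives are also computed pointwise, and the term on $\{U=0\}$ enters them with
opposite signs. Equating them kills that term and leaves the chain rule. -/
theorem integral_abs_mul_fderiv [Fact (1 ≤ q)] (hq : q ≠ ⊤)
    (U H : Lp ℝ q (volume : Measure (EuclideanSpace ℝ (Fin d)))) (v : EuclideanSpace ℝ (Fin d))
    (hUH : ∀ φ : EuclideanSpace ℝ (Fin d) → ℝ, ContDiff ℝ ∞ φ → HasCompactSupport φ →
      ∫ x, U x * fderiv ℝ φ x v = - ∫ x, H x * φ x)
    {φ : EuclideanSpace ℝ (Fin d) → ℝ} (hφ : ContDiff ℝ ∞ φ) (hφc : HasCompactSupport φ) :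
    ∫ x, |U x| * fderiv ℝ φ x v = - ∫ x, (SignType.sign (U x) * H x) * φ x ∧
      ∫ x, (if U x = 0 then |H x| else 0) * φ x = 0 := by
  have hφ0 := hφ.continuous
  set L := ∫ x, |U x| * fderiv ℝ φ x v with hL
  set A : ℝ → ℝ := fun t => ∫ x, |U x| * φ (x - t • v) with hA
  have hAeq : ∀ t, A t = ∫ x, |translate (t • v) U x| * φ x := by
    intro t
    have e := integral_translate_mul |U| φ (t • v)
    have e1 : A t = ∫ x, (|U| : Lp ℝ q volume) x * φ (x - t • v) := by
      apply integral_congr_ae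
      filter_upwards [Lp.coeFn_abs U] with x hx
      rw [hx]
    rw [e1, ← e]
    apply integral_congr_ae
    have h2 : ∀ᵐ x, (|U| : Lp ℝ q volume) (x + t • v) = |U (x + t • v)| :=
      (measurePreserving_add_right volume (t • v)).quasiMeasurePreserving.ae (Lp.coeFn_abs U)
    filter_upwards [coeFn_translate (t • v) U, coeFn_translate (t • v) |U|, h2] with x h3 h4 h5
    rw [h3, h4, h5]
  have hAd : HasDerivAt A (-L) 0 := by
    have hl : LocallyIntegrable (fun x => |U x|) volume := fun x =>
      ((locallyIntegrable_Lp U) x).norm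
    simpa [hL] using hasDerivAt_integral_mul_comp_sub hl hφ hφc v 0
  set B : ℝ → ℝ := fun t => ∫ x, |U x + t * H x| * φ x with hB
  have hBeq : ∀ t, B t = ∫ x, |(U + t • H) x| * φ x := by
    intro t
    apply integral_congr_ae
    filter_upwards [Lp.coeFn_add U (t • H), Lp.coeFn_smul t H] with x h1 h2
    simp only [h1, Pi.add_apply, h2, Pi.smul_apply, smul_eq_mul]
  have hBd : HasDerivAt B (-L) 0 := by
    obtain ⟨C, hC⟩ := exists_abs_integral_abs_sub_abs_le (q := q) hφ0 hφc
    have hR := hasDerivAt_translate hq U H v hUH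
    -- The absolute value does not increase distances, so `B t - A t` inherits the $o(t)$ error of
    -- the first-order expansion of the translate.
    have ho : (fun t => B t - A t) =o[𝓝 0] fun t : ℝ => t - 0 := by
      rw [hasDerivAt_iff_isLittleO] at hR
      refine Asymptotics.IsBigO.trans_isLittleO (Asymptotics.IsBigO.of_bound C
        (Eventually.of_forall fun t => ?_)) hR
      rw [hAeq, hBeq, Real.norm_eq_abs]
      refine (hC (U + t • H) (translate (t • v) U)).trans_eq ?_
      rw [← norm_neg]
      simp only [zero_smul, translate_zero, sub_zero]
      congr 2
      abel
    have h1 : HasDerivAt (fun t => B t - A t) 0 0 := by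
      rw [hasDerivAt_iff_isLittleO]
      have h0 : B 0 - A 0 = 0 := by simp [hA, hB]
      simpa [h0] using ho
    have h2 := h1.add hAd
    rw [zero_add] at h2
    refine h2.congr_of_eventuallyEq (Eventually.of_forall fun t => ?_)
    simp
  have hB0 : B 0 = ∫ x, |U x| * φ x := by simp [hB]
  have hi1 : Integrable (fun x => (SignType.sign (U x) * H x) * φ x) volume := by
    refine (Lp_integrable_mul H hφ0 hφc).mono ((aestronglyMeasurable_sign_mul
      (Lp.aestronglyMeasurable U) (Lp.aestronglyMeasurable H)).mul hφ0.aestronglyMeasurable)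
      (Eventually.of_forall fun x => ?_)
    rw [norm_mul _ (φ x), norm_mul _ (φ x)]
    exact mul_le_mul_of_nonneg_right (abs_sign_mul_le _ _) (norm_nonneg _)
  have hi2 : Integrable (fun x => (if U x = 0 then |H x| else 0) * φ x) volume := by
    refine (Lp_integrable_mul H hφ0 hφc).mono (AEStronglyMeasurable.mul ?_
      hφ0.aestronglyMeasurable) (Eventually.of_forall fun x => ?_)
    · have hs : MeasurableSet {x | U x = 0} :=
        (Lp.stronglyMeasurable U).measurable (measurableSet_singleton 0)
      exact ((Lp.stronglyMeasurable H).norm.ite hs stronglyMeasurable_const).aestronglyMeasurable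
    · rw [norm_mul, norm_mul]
      gcongr
      split_ifs <;> simp
  have e1 : -L = (∫ x, (SignType.sign (U x) * H x) * φ x) +
      ∫ x, (if U x = 0 then |H x| else 0) * φ x := by
    have := tendsto_nhds_unique
      ((tendsto_slope_comp_mul hBd 1).congr fun t => by rw [hB0, one_mul])
      (tendsto_slope_integral_abs U H hφ0 hφc)
    rw [← integral_add hi1 hi2, ← one_mul (-L), this]
    simp only [add_mul]
  -- The left derivative, obtained as a right derivative with `-H` in place of `H`.
  have e2 : L = -(∫ x, (SignType.sign (U x) * H x) * φ x) +
      ∫ x, (if U x = 0 then |H x| else 0) * φ x := by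
    have h1 : ∀ t : ℝ, (∫ x, |U x + t * (-H : Lp ℝ q volume) x| * φ x) = B (-1 * t) := by
      intro t
      apply integral_congr_ae
      filter_upwards [Lp.coeFn_neg H] with x hx
      simp only [hx, Pi.neg_apply]
      congr 2; ring
    have := tendsto_nhds_unique
      ((tendsto_slope_comp_mul hBd (-1)).congr fun t => by rw [hB0, ← h1])
      (tendsto_slope_integral_abs U (-H) hφ0 hφc)
    rw [neg_one_mul, neg_neg] at this
    have hi3 : Integrable (fun x => -((SignType.sign (U x) * H x) * φ x)) volume := hi1.neg
    rw [← integral_neg, ← integral_add hi3 hi2, this]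
    apply integral_congr_ae
    filter_upwards [Lp.coeFn_neg H] with x hx
    simp only [hx, Pi.neg_apply, abs_neg]
    ring
  constructor <;> linarith

/-! ### Weak gradients: uniqueness and consequences for $L^q$ pairs -/

theorem HasWeakGradient.congr {u u' : EuclideanSpace ℝ (Fin d) → ℝ}
    {g g' : EuclideanSpace ℝ (Fin d) → EuclideanSpace ℝ (Fin d)} (h : HasWeakGradient u g)
    (hu : u =ᵐ[volume] u') (hg : g =ᵐ[volume] g') : HasWeakGradient u' g' where
  locallyIntegrable := h.locallyIntegrable.congr hu
  locallyIntegrable_grad := h.locallyIntegrable_grad.congr hg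
  integral_eq φ hφ hφc v := by
    have e1 : ∫ x, u' x * fderiv ℝ φ x v = ∫ x, u x * fderiv ℝ φ x v := by
      apply integral_congr_ae
      filter_upwards [hu] with x hx
      rw [hx]
    have e2 : ∫ x, inner ℝ (g' x) v * φ x = ∫ x, inner ℝ (g x) v * φ x := by
      apply integral_congr_ae
      filter_upwards [hg] with x hx
      rw [hx]
    rw [e1, e2, h.integral_eq φ hφ hφc v]

theorem LocallyIntegrable.inner_const {g : EuclideanSpace ℝ (Fin d) → EuclideanSpace ℝ (Fin d)}
    (hg : LocallyIntegrable g volume) (v : EuclideanSpace ℝ (Fin d)) :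
    LocallyIntegrable (fun x => inner ℝ (g x) v) volume := fun x =>
  (hg x).imp fun _ ⟨hs, hi⟩ => ⟨hs, Integrable.inner_const hi v⟩

/-- The exceptional null set may depend on the direction, but the finitely many basis directions
suffice. -/
theorem ext_ae_inner {g g' : EuclideanSpace ℝ (Fin d) → EuclideanSpace ℝ (Fin d)}
    {P : EuclideanSpace ℝ (Fin d) → Prop}
    (h : ∀ v, ∀ᵐ x, P x → (inner ℝ (g x) v : ℝ) = inner ℝ (g' x) v) :
    ∀ᵐ x, P x → g x = g' x := by
  have h1 : ∀ i : Fin d, ∀ᵐ x, P x → (inner ℝ (g x) (EuclideanSpace.single i 1) : ℝ) =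
      inner ℝ (g' x) (EuclideanSpace.single i 1) := fun i => h _
  filter_upwards [ae_all_iff.2 h1] with x hx hP
  ext i
  simpa [EuclideanSpace.inner_single_right] using hx i hP

theorem HasWeakGradient.ae_unique {u : EuclideanSpace ℝ (Fin d) → ℝ}
    {g g' : EuclideanSpace ℝ (Fin d) → EuclideanSpace ℝ (Fin d)} (h : HasWeakGradient u g)
    (h' : HasWeakGradient u g') : g =ᵐ[volume] g' := by
  have := ext_ae_inner (P := fun _ => True) (g := g) (g' := g') fun v => by
    filter_upwards [ae_eq_of_integral_contDiff_smul_eq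
      (LocallyIntegrable.inner_const h.locallyIntegrable_grad v)
      (LocallyIntegrable.inner_const h'.locallyIntegrable_grad v) fun φ hφ hφc => by
        have h1 := h.integral_eq φ hφ hφc v
        rw [h'.integral_eq φ hφ hφc v, neg_inj] at h1
        simpa [mul_comm] using h1.symm] with x hx _
    exact hx
  filter_upwards [this] with x hx using hx trivial

/-- Uniqueness makes the arbitrary choice inside `weakGrad` harmless. -/
theorem HasWeakGradient.weakGrad_ae_eq {u : EuclideanSpace ℝ (Fin d) → ℝ}
    {g : EuclideanSpace ℝ (Fin d) → EuclideanSpace ℝ (Fin d)} (h : HasWeakGradient u g) :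
    weakGrad u =ᵐ[volume] g := by
  have hex : ∃ g, HasWeakGradient u g := ⟨g, h⟩
  rw [weakGrad, dif_pos hex]
  exact hex.choose_spec.ae_unique h

theorem MemW1p.hasWeakGradient {p : ℝ} {u : EuclideanSpace ℝ (Fin d) → ℝ} (h : MemW1p p u) :
    HasWeakGradient u (weakGrad u) := by
  obtain ⟨-, g, hg, -⟩ := h
  exact hg.congr .rfl hg.weakGrad_ae_eq.symm

theorem MemW1p.memLp_weakGrad {p : ℝ} {u : EuclideanSpace ℝ (Fin d) → ℝ} (h : MemW1p p u) :
    MemLp (weakGrad u) (ENNReal.ofReal p) volume := by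
  obtain ⟨-, g, hg, hm⟩ := h
  exact hm.ae_eq hg.weakGrad_ae_eq.symm

/-- The directional component `⟨G, v⟩` of an `L^q` vector field. -/
noncomputable def innerLp (v : EuclideanSpace ℝ (Fin d))
    (G : Lp (EuclideanSpace ℝ (Fin d)) q (volume : Measure (EuclideanSpace ℝ (Fin d)))) :
    Lp ℝ q (volume : Measure (EuclideanSpace ℝ (Fin d))) :=
  (innerSL ℝ v).compLp G

theorem coeFn_innerLp (v : EuclideanSpace ℝ (Fin d))
    (G : Lp (EuclideanSpace ℝ (Fin d)) q (volume : Measure (EuclideanSpace ℝ (Fin d)))) :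
    innerLp v G =ᵐ[volume] fun x => inner ℝ (G x) v := by
  filter_upwards [(innerSL ℝ v).coeFn_compLp G] with x hx
  rw [innerLp, hx, innerSL_apply_apply, real_inner_comm]

theorem norm_innerLp_le (v : EuclideanSpace ℝ (Fin d))
    (G : Lp (EuclideanSpace ℝ (Fin d)) q (volume : Measure (EuclideanSpace ℝ (Fin d)))) :
    ‖innerLp v G‖ ≤ ‖v‖ * ‖G‖ := by
  simpa [innerLp] using (innerSL ℝ v).norm_compLp_le G

section Lp

variable {U : Lp ℝ q (volume : Measure (EuclideanSpace ℝ (Fin d)))}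
  {G : Lp (EuclideanSpace ℝ (Fin d)) q (volume : Measure (EuclideanSpace ℝ (Fin d)))}

theorem HasWeakGradient.integral_innerLp (h : HasWeakGradient U G) (v : EuclideanSpace ℝ (Fin d))
    (φ : EuclideanSpace ℝ (Fin d) → ℝ) (hφ : ContDiff ℝ ∞ φ) (hφc : HasCompactSupport φ) :
    ∫ x, U x * fderiv ℝ φ x v = - ∫ x, innerLp v G x * φ x := by
  rw [h.integral_eq φ hφ hφc v]
  congr 1
  apply integral_congr_ae
  filter_upwards [coeFn_innerLp v G] with x hx
  rw [hx]

theorem HasWeakGradient.norm_translate_sub_le [Fact (1 ≤ q)] (hq : q ≠ ⊤)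
    (h : HasWeakGradient U G) (v : EuclideanSpace ℝ (Fin d)) :
    ‖translate v U - U‖ ≤ ‖v‖ * ‖G‖ :=
  (NPartition.norm_translate_sub_le hq U (innerLp v G) v (h.integral_innerLp v)).trans
    (norm_innerLp_le v G)

theorem HasWeakGradient.ae_eq_zero [Fact (1 ≤ q)] (hq : q ≠ ⊤) (h : HasWeakGradient U G) :
    ∀ᵐ x, U x = 0 → G x = 0 := by
  refine ext_ae_inner (g' := fun _ => 0) fun v => ?_
  have hs : MeasurableSet {x | U x = 0} :=
    (Lp.stronglyMeasurable U).measurable (measurableSet_singleton 0)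
  have hl : LocallyIntegrable (fun x => if U x = 0 then |innerLp v G x| else 0) volume := by
    refine (locallyIntegrable_Lp (innerLp v G)).mono
      ((Lp.stronglyMeasurable (innerLp v G)).norm.ite hs
        stronglyMeasurable_const).aestronglyMeasurable (Eventually.of_forall fun x => ?_)
    split_ifs <;> simp
  filter_upwards [ae_eq_zero_of_integral_contDiff_smul_eq_zero hl fun φ hφ hφc => by
    simpa only [smul_eq_mul, mul_comm] using
      (integral_abs_mul_fderiv hq U _ v (h.integral_innerLp v) hφ hφc).2,
    coeFn_innerLp v G] with x h1 h2 h3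
  rw [if_pos h3, abs_eq_zero, h2] at h1
  rw [h1, inner_zero_left]

theorem HasWeakGradient.abs [Fact (1 ≤ q)] (hq : q ≠ ⊤) (h : HasWeakGradient U G) :
    HasWeakGradient (fun x => |U x|) (fun x => (SignType.sign (U x) : ℝ) • G x) where
  locallyIntegrable := fun x => (locallyIntegrable_Lp U x).norm
  locallyIntegrable_grad := by
    refine (locallyIntegrable_Lp G).mono ?_ (Eventually.of_forall fun x => ?_)
    · have := aestronglyMeasurable_sign_mul (Lp.aestronglyMeasurable U)
        (aestronglyMeasurable_const (b := (1 : ℝ)))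
      simp only [mul_one] at this
      exact this.smul (Lp.aestronglyMeasurable G)
    · rw [norm_smul]
      have := abs_sign_mul_le (U x) 1
      simp only [mul_one, abs_one] at this
      exact mul_le_of_le_one_left (norm_nonneg _) this
  integral_eq φ hφ hφc v := by
    rw [(integral_abs_mul_fderiv hq U _ v (h.integral_innerLp v) hφ hφc).1]
    congr 1
    apply integral_congr_ae
    filter_upwards [coeFn_innerLp v G] with x hx
    rw [hx, real_inner_smul_left]

end Lp

/-! ### Compactness in $L^q$ by averaging over a grid of cubes -/

theorem Lp_enorm_rpow_eq_lintegral {α E : Type*} [MeasurableSpace α] {μ : Measure α}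
    [NormedAddCommGroup E] (hq0 : q ≠ 0) (hq : q ≠ ⊤) (f : Lp E q μ) :
    ‖f‖ₑ ^ q.toReal = ∫⁻ x, ‖f x‖ₑ ^ q.toReal ∂μ := by
  rw [Lp.enorm_def, eLpNorm_eq_lintegral_rpow_enorm_toReal hq0 hq, ← ENNReal.rpow_mul,
    one_div, inv_mul_cancel₀ (ENNReal.toReal_pos hq0 hq).ne', ENNReal.rpow_one]

/-- Jensen's inequality for the $q$-th power, deduced from the monotonicity of $L^r$ norms in $r$ on
a probability space. -/
theorem enorm_integral_rpow_le_lintegral {α : Type*} [MeasurableSpace α] {μ : Measure α}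
    [IsProbabilityMeasure μ] {f : α → ℝ} (hf : AEStronglyMeasurable f μ) (hq1 : 1 ≤ q)
    (hq : q ≠ ⊤) :
    ‖∫ x, f x ∂μ‖ₑ ^ q.toReal ≤ ∫⁻ x, ‖f x‖ₑ ^ q.toReal ∂μ := by
  have hq0 : q ≠ 0 := (one_pos.trans_le hq1).ne'
  have hp := ENNReal.toReal_pos hq0 hq
  have h1 : ‖∫ x, f x ∂μ‖ₑ ≤ eLpNorm f q μ := by
    refine (enorm_integral_le_lintegral_enorm f).trans ?_
    rw [← eLpNorm_one_eq_lintegral_enorm]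
    exact eLpNorm_le_eLpNorm_of_exponent_le hq1 hf
  refine (ENNReal.rpow_le_rpow h1 hp.le).trans_eq ?_
  rw [eLpNorm_eq_lintegral_rpow_enorm_toReal hq0 hq, ← ENNReal.rpow_mul,
    one_div, inv_mul_cancel₀ hp.ne', ENNReal.rpow_one]

/-- The cube of side `h` with index `k` in the standard grid. -/
def gridCube (h : ℝ) (k : Fin d → ℤ) : Set (EuclideanSpace ℝ (Fin d)) :=
  {x | ∀ i, x i ∈ Set.Ico (k i * h) ((k i + 1) * h)}

theorem volume_forall_mem (s : Fin d → Set ℝ) (hs : ∀ i, MeasurableSet (s i)) :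
    MeasurableSet {x : EuclideanSpace ℝ (Fin d) | ∀ i, x i ∈ s i} ∧
    volume {x : EuclideanSpace ℝ (Fin d) | ∀ i, x i ∈ s i} = ∏ i, volume (s i) := by
  have e : {x : EuclideanSpace ℝ (Fin d) | ∀ i, x i ∈ s i} =
      WithLp.ofLp ⁻¹' (Set.univ.pi s) := by ext x; simp
  have hm := MeasurableSet.univ_pi hs
  have hv := PiLp.volume_preserving_ofLp (Fin d)
  refine ⟨e ▸ hv.measurable hm, ?_⟩
  rw [e, hv.measure_preimage hm.nullMeasurableSet, volume_pi_pi]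

theorem measurableSet_gridCube (h : ℝ) (k : Fin d → ℤ) : MeasurableSet (gridCube h k) :=
  (volume_forall_mem _ fun _ => measurableSet_Ico).1

theorem volume_gridCube (h : ℝ) (k : Fin d → ℤ) :
    volume (gridCube h k) = ENNReal.ofReal h ^ d := by
  rw [gridCube, (volume_forall_mem _ fun _ => measurableSet_Ico).2]
  simp [Real.volume_Ico, add_mul]

theorem mem_gridCube_floor {h : ℝ} (hh : 0 < h) (x : EuclideanSpace ℝ (Fin d)) :
    x ∈ gridCube h (fun i => ⌊x i / h⌋) := by
  intro i
  rw [Set.mem_Ico, ← le_div_iff₀ hh, ← div_lt_iff₀ hh]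
  exact ⟨Int.floor_le _, Int.lt_floor_add_one _⟩

theorem eq_floor_of_mem_gridCube {h : ℝ} (hh : 0 < h) {x : EuclideanSpace ℝ (Fin d)}
    {k : Fin d → ℤ} (hx : x ∈ gridCube h k) : k = fun i => ⌊x i / h⌋ := by
  ext i
  have := hx i
  rw [Set.mem_Ico, ← le_div_iff₀ hh, ← div_lt_iff₀ hh] at this
  exact (Int.floor_eq_iff.2 this).symm

/-- The cube of half-side `h` centred at the origin. -/
def centredCube (d : ℕ) (h : ℝ) : Set (EuclideanSpace ℝ (Fin d)) :=
  {x | ∀ i, x i ∈ Set.Icc (-h) h}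

theorem measurableSet_centredCube (h : ℝ) : MeasurableSet (centredCube d h) :=
  (volume_forall_mem _ fun _ => measurableSet_Icc).1

theorem volume_centredCube (h : ℝ) :
    volume (centredCube d h) = 2 ^ d * ENNReal.ofReal h ^ d := by
  rw [centredCube, (volume_forall_mem _ fun _ => measurableSet_Icc).2]
  simp only [Real.volume_Icc, Finset.prod_const, Finset.card_univ, Fintype.card_fin]
  rw [← mul_pow]
  congr 1
  rw [sub_neg_eq_add, ← two_mul, ENNReal.ofReal_mul zero_le_two, ENNReal.ofReal_ofNat]

theorem norm_le_of_mem_centredCube {h : ℝ} (hh : 0 ≤ h) {x : EuclideanSpace ℝ (Fin d)}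
    (hx : x ∈ centredCube d h) : ‖x‖ ≤ √d * h := by
  rw [EuclideanSpace.norm_eq, ← Real.sqrt_sq hh, ← Real.sqrt_mul (Nat.cast_nonneg d)]
  apply Real.sqrt_le_sqrt
  calc ∑ i, ‖x i‖ ^ 2 ≤ ∑ _i : Fin d, h ^ 2 := by
        apply Finset.sum_le_sum fun i _ => ?_
        rw [Real.norm_eq_abs]
        exact pow_le_pow_left₀ (abs_nonneg _) (abs_le.2 (hx i)) 2
    _ = d * h ^ 2 := by simp

theorem sub_mem_centredCube {h : ℝ} {x y : EuclideanSpace ℝ (Fin d)} {k : Fin d → ℤ}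
    (hx : x ∈ gridCube h k) (hy : y ∈ gridCube h k) : y - x ∈ centredCube d h := by
  intro i
  have h1 := hx i
  have h2 := hy i
  rw [Set.mem_Ico] at h1 h2
  rw [PiLp.sub_apply, Set.mem_Icc]
  constructor <;> linarith

theorem finite_gridCube_meets_closedBall {h : ℝ} (hh : 0 < h) (R : ℝ) :
    {k : Fin d → ℤ | ∃ x ∈ Metric.closedBall (0 : EuclideanSpace ℝ (Fin d)) R,
      x ∈ gridCube h k}.Finite := by
  refine (Set.Finite.pi' (t := fun _ : Fin d => Set.Icc ⌊-R / h⌋ ⌊R / h⌋)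
    fun _ => Set.finite_Icc _ _).subset ?_
  rintro k ⟨x, hx, hk⟩ i
  rw [eq_floor_of_mem_gridCube hh hk]
  rw [mem_closedBall_zero_iff] at hx
  have h1 := abs_le.1 ((PiLp.norm_apply_le x i).trans hx)
  exact ⟨Int.floor_le_floor (by gcongr; exact h1.1), Int.floor_le_floor (by gcongr; exact h1.2)⟩

/-- The mean of `U` over a grid cube. -/
noncomputable def gridMean (h : ℝ) (U : EuclideanSpace ℝ (Fin d) → ℝ) (k : Fin d → ℤ) : ℝ :=
  ∫ x, U x ∂(ProbabilityTheory.cond volume (gridCube h k))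

theorem isProbabilityMeasure_cond_gridCube {h : ℝ} (hh : 0 < h) (k : Fin d → ℤ) :
    IsProbabilityMeasure (ProbabilityTheory.cond volume (gridCube h k)) := by
  refine ProbabilityTheory.cond_isProbabilityMeasure_of_finite ?_ ?_
  · rw [volume_gridCube]
    exact pow_ne_zero _ (ENNReal.ofReal_pos.2 hh).ne'
  · rw [volume_gridCube]
    exact ENNReal.pow_ne_top ENNReal.ofReal_ne_top

theorem lintegral_cond_gridCube (h : ℝ) (k : Fin d → ℤ)
    (f : EuclideanSpace ℝ (Fin d) → ℝ≥0∞) :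
    ∫⁻ x, f x ∂(ProbabilityTheory.cond volume (gridCube h k)) =
      (ENNReal.ofReal h ^ d)⁻¹ * ∫⁻ x in gridCube h k, f x := by
  rw [ProbabilityTheory.cond, lintegral_smul_measure, volume_gridCube, smul_eq_mul]

theorem Lp_integrable_cond_gridCube [Fact (1 ≤ q)] {h : ℝ} (hh : 0 < h) (k : Fin d → ℤ)
    (U : Lp ℝ q (volume : Measure (EuclideanSpace ℝ (Fin d)))) :
    Integrable U (ProbabilityTheory.cond volume (gridCube h k)) := by
  have : IsFiniteMeasure (volume.restrict (gridCube (d := d) h k)) := by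
    refine ⟨?_⟩
    rw [Measure.restrict_apply_univ, volume_gridCube]
    exact ENNReal.pow_lt_top ENNReal.ofReal_lt_top
  rw [ProbabilityTheory.cond]
  refine Integrable.smul_measure (((Lp.memLp U).restrict _).integrable Fact.out) ?_
  rw [volume_gridCube]
  exact ENNReal.inv_ne_top.2 (pow_ne_zero _ (ENNReal.ofReal_pos.2 hh).ne')

theorem enorm_gridMean_rpow_le [Fact (1 ≤ q)] (hq : q ≠ ⊤) {h : ℝ} (hh : 0 < h)
    (U : Lp ℝ q (volume : Measure (EuclideanSpace ℝ (Fin d)))) (k : Fin d → ℤ) :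
    ‖gridMean h U k‖ₑ ^ q.toReal ≤ (ENNReal.ofReal h ^ d)⁻¹ * ‖U‖ₑ ^ q.toReal := by
  have := isProbabilityMeasure_cond_gridCube hh k
  have hq1 : 1 ≤ q := Fact.out
  rw [Lp_enorm_rpow_eq_lintegral (one_pos.trans_le hq1).ne' hq]
  refine (enorm_integral_rpow_le_lintegral (Lp_integrable_cond_gridCube hh k U).1
    Fact.out hq).trans ?_
  rw [lintegral_cond_gridCube]
  gcongr
  exact Measure.restrict_le_self

/-- Jensen bounds the left side by the mean of $|U(x)-U(y)|^q$ over the cube of `x`. Writing $y=x+z$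
puts $z$ in a centred cube independent of `x` and `k`, which prepares for Tonelli. -/
theorem enorm_sub_gridMean_rpow_le [Fact (1 ≤ q)] (hq : q ≠ ⊤) {h : ℝ} (hh : 0 < h)
    (U : Lp ℝ q (volume : Measure (EuclideanSpace ℝ (Fin d)))) {k : Fin d → ℤ}
    {x : EuclideanSpace ℝ (Fin d)} (hx : x ∈ gridCube h k) :
    ‖U x - gridMean h U k‖ₑ ^ q.toReal ≤
      (ENNReal.ofReal h ^ d)⁻¹ * ∫⁻ z in centredCube d h, ‖U (x + z) - U x‖ₑ ^ q.toReal := by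
  have := isProbabilityMeasure_cond_gridCube hh k
  have hi := Lp_integrable_cond_gridCube hh k U
  have e : U x - gridMean h U k =
      ∫ y, (U x - U y) ∂(ProbabilityTheory.cond volume (gridCube h k)) := by
    rw [integral_sub (integrable_const _) hi, gridMean]
    simp
  rw [e]
  refine (enorm_integral_rpow_le_lintegral (aestronglyMeasurable_const.sub hi.1)
    Fact.out hq).trans ?_
  rw [lintegral_cond_gridCube]
  refine mul_le_mul_right ?_ _
  rw [← lintegral_indicator (measurableSet_gridCube h k),
    ← lintegral_indicator (measurableSet_centredCube h),
    ← lintegral_add_left_eq_self _ x]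
  apply lintegral_mono fun z => ?_
  by_cases hz : x + z ∈ gridCube h k
  · have hz' : z ∈ centredCube d h := by simpa using sub_mem_centredCube hx hz
    rw [Set.indicator_of_mem hz, Set.indicator_of_mem hz', Pi.sub_apply, ← enorm_neg, neg_sub]
  · rw [Set.indicator_of_notMem hz]
    exact zero_le

theorem lintegral_lintegral_translate_le [Fact (1 ≤ q)] (hq : q ≠ ⊤) {h : ℝ} {ρ : ℝ≥0∞}
    (U : Lp ℝ q (volume : Measure (EuclideanSpace ℝ (Fin d))))
    (hU : ∀ z ∈ centredCube d h, ‖translate z U - U‖ₑ ≤ ρ) :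
    ∫⁻ x, ∫⁻ z in centredCube d h, ‖U (x + z) - U x‖ₑ ^ q.toReal ≤
      2 ^ d * ENNReal.ofReal h ^ d * ρ ^ q.toReal := by
  have hq1 : 1 ≤ q := Fact.out
  have hU' := (Lp.stronglyMeasurable U).measurable
  have hm : Measurable (fun p : EuclideanSpace ℝ (Fin d) × EuclideanSpace ℝ (Fin d) =>
      ‖U (p.1 + p.2) - U p.1‖ₑ ^ q.toReal) := by fun_prop
  rw [lintegral_lintegral_swap hm.aemeasurable]
  calc ∫⁻ z in centredCube d h, ∫⁻ x, ‖U (x + z) - U x‖ₑ ^ q.toReal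
      ≤ ∫⁻ z in centredCube d h, ρ ^ q.toReal := by
        apply setLIntegral_mono measurable_const fun z hz => ?_
        have e : ∫⁻ x, ‖U (x + z) - U x‖ₑ ^ q.toReal = ‖translate z U - U‖ₑ ^ q.toReal := by
          rw [Lp_enorm_rpow_eq_lintegral (one_pos.trans_le hq1).ne' hq]
          apply lintegral_congr_ae
          filter_upwards [Lp.coeFn_sub (translate z U) U, coeFn_translate z U] with x h1 h2
          rw [h1, Pi.sub_apply, h2]
        rw [e]
        exact ENNReal.rpow_le_rpow (hU z hz) ENNReal.toReal_nonneg
    _ = 2 ^ d * ENNReal.ofReal h ^ d * ρ ^ q.toReal := by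
        rw [setLIntegral_const, volume_centredCube, mul_comm]

/-- The step function with values `b k` on the grid cubes with index in `S`. -/
noncomputable def gridStep (q : ℝ≥0∞) (h : ℝ) (S : Finset (Fin d → ℤ)) (b : S → ℝ) :
    Lp ℝ q (volume : Measure (EuclideanSpace ℝ (Fin d))) :=
  ∑ k : S, b k • indicatorConstLp q (measurableSet_gridCube h k.1)
    (by rw [volume_gridCube]; exact ENNReal.pow_ne_top ENNReal.ofReal_ne_top) (1 : ℝ)

theorem continuous_gridStep [Fact (1 ≤ q)] (h : ℝ) (S : Finset (Fin d → ℤ)) :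
    Continuous (gridStep q h S) :=
  continuous_finsetSum _ fun k _ => (continuous_apply k).smul continuous_const

theorem coeFn_gridStep (h : ℝ) (S : Finset (Fin d → ℤ)) (b : S → ℝ) :
    gridStep q h S b =ᵐ[volume]
      fun x => ∑ k : S, b k * (gridCube h k.1).indicator (fun _ => (1 : ℝ)) x := by
  refine (Lp.coeFn_finsetSum _ _).trans ?_
  have h1 : ∀ k : S, ∀ᵐ x, (b k • indicatorConstLp q (measurableSet_gridCube h k.1)
      (by rw [volume_gridCube]; exact ENNReal.pow_ne_top ENNReal.ofReal_ne_top) (1 : ℝ) :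
        Lp ℝ q (volume : Measure (EuclideanSpace ℝ (Fin d)))) x =
      b k * (gridCube h k.1).indicator (fun _ => (1 : ℝ)) x := fun k => by
    filter_upwards [Lp.coeFn_smul (b k) (indicatorConstLp q (measurableSet_gridCube h k.1)
      (by rw [volume_gridCube]; exact ENNReal.pow_ne_top ENNReal.ofReal_ne_top) (1 : ℝ)),
      indicatorConstLp_coeFn (p := q) (hs := measurableSet_gridCube h k.1)
        (hμs := by rw [volume_gridCube]; exact ENNReal.pow_ne_top ENNReal.ofReal_ne_top)
        (c := (1 : ℝ))] with x h1 h2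
    rw [h1, Pi.smul_apply, h2, smul_eq_mul]
  filter_upwards [ae_all_iff.2 h1] with x hx
  rw [Finset.sum_apply]
  exact Finset.sum_congr rfl fun k _ => hx k

/-- The pointwise bound is integrated in `x`. The factor `2 ^ d` is the volume ratio of the centred
cube of side `2 * h` to a grid cube. Off the cubes indexed by `S` both functions vanish a.e. -/
theorem enorm_sub_gridStep_rpow_le [Fact (1 ≤ q)] (hq : q ≠ ⊤) {h : ℝ} (hh : 0 < h) {ρ : ℝ≥0∞}
    (U : Lp ℝ q (volume : Measure (EuclideanSpace ℝ (Fin d))))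
    (hU : ∀ z ∈ centredCube d h, ‖translate z U - U‖ₑ ≤ ρ) {S : Finset (Fin d → ℤ)}
    (hS : ∀ᵐ x, U x ≠ 0 → (fun i => ⌊x i / h⌋) ∈ S) :
    ‖U - gridStep q h S (fun k => gridMean h U k)‖ₑ ^ q.toReal ≤ 2 ^ d * ρ ^ q.toReal := by
  have hq1 : 1 ≤ q := Fact.out
  have hq0 := (one_pos.trans_le hq1).ne'
  have hc0 : ENNReal.ofReal h ^ d ≠ 0 := pow_ne_zero _ (ENNReal.ofReal_pos.2 hh).ne'
  have hct : ENNReal.ofReal h ^ d ≠ ⊤ := ENNReal.pow_ne_top ENNReal.ofReal_ne_top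
  rw [Lp_enorm_rpow_eq_lintegral hq0 hq]
  calc ∫⁻ x, ‖(U - gridStep q h S (fun k => gridMean h U k)) x‖ₑ ^ q.toReal
      ≤ ∫⁻ x, (ENNReal.ofReal h ^ d)⁻¹ *
          ∫⁻ z in centredCube d h, ‖U (x + z) - U x‖ₑ ^ q.toReal := by
        apply lintegral_mono_ae
        filter_upwards [hS, Lp.coeFn_sub U (gridStep q h S (fun k => gridMean h U k)),
          coeFn_gridStep (q := q) h S (fun k => gridMean h U k)] with x h1 h2 h3
        rw [h2, Pi.sub_apply, h3]
        by_cases hx : (fun i => ⌊x i / h⌋) ∈ S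
        · rw [Finset.sum_eq_single ⟨_, hx⟩]
          · rw [Set.indicator_of_mem (mem_gridCube_floor hh x), mul_one]
            exact enorm_sub_gridMean_rpow_le hq hh U (mem_gridCube_floor hh x)
          · intro k _ hk
            rw [Set.indicator_of_notMem, mul_zero]
            exact fun hxk => hk (Subtype.ext (eq_floor_of_mem_gridCube hh hxk))
          · simp
        · have h0 : U x = 0 := by
            by_contra h0
            exact hx (h1 h0)
          rw [h0, Finset.sum_eq_zero]
          · simp [ENNReal.toReal_pos hq0 hq]
          · intro k _
            rw [Set.indicator_of_notMem, mul_zero]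
            exact fun hxk => hx (eq_floor_of_mem_gridCube hh hxk ▸ k.2)
    _ ≤ (ENNReal.ofReal h ^ d)⁻¹ * (2 ^ d * ENNReal.ofReal h ^ d * ρ ^ q.toReal) := by
        rw [lintegral_const_mul' _ _ (ENNReal.inv_ne_top.2 hc0)]
        gcongr
        exact lintegral_lintegral_translate_le hq U hU
    _ = 2 ^ d * ρ ^ q.toReal := by
        rw [mul_comm (2 ^ d), mul_assoc, ← mul_assoc, ENNReal.inv_mul_cancel hc0 hct, one_mul]

/-- A bounded family of `L^q` functions that vanish outside a common ball and whose translates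
depend on the translation vector in a uniformly Lipschitz way is totally bounded. -/
theorem totallyBounded_of_norm_translate_sub_le [Fact (1 ≤ q)] (hq : q ≠ ⊤)
    {K : Set (Lp ℝ q (volume : Measure (EuclideanSpace ℝ (Fin d))))} {R C M : ℝ} (hM : 0 ≤ M)
    (hC : ∀ U ∈ K, ‖U‖ ≤ C) (hT : ∀ U ∈ K, ∀ z, ‖translate z U - U‖ ≤ ‖z‖ * M)
    (hR : ∀ U ∈ K, ∀ᵐ x, U x ≠ 0 → x ∈ Metric.closedBall (0 : EuclideanSpace ℝ (Fin d)) R) :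
    TotallyBounded K := by
  have hq1 : 1 ≤ q := Fact.out
  have hq0 := (one_pos.trans_le hq1).ne'
  have hp := ENNReal.toReal_pos hq0 hq
  have hp1 : 1 ≤ q.toReal := by simpa using ENNReal.toReal_mono hq hq1
  rw [Metric.totallyBounded_iff]
  intro ε hε
  -- Chosen so that the approximation error $2^d\sqrt d\,hM$ is below $\varepsilon/2$; the `+ 1`
  -- covers `M = 0` and makes the inequality strict.
  set h : ℝ := ε / (2 * 2 ^ d * (√d * M + 1)) with hh_def
  have hh : 0 < h := by positivity
  set S : Finset (Fin d → ℤ) := (finite_gridCube_meets_closedBall (d := d) hh R).toFinset with hSd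
  have hSR : ∀ U ∈ K, ∀ᵐ x, U x ≠ 0 → (fun i => ⌊x i / h⌋) ∈ S := by
    intro U hU
    filter_upwards [hR U hU] with x hx h0
    rw [hSd, Set.Finite.mem_toFinset]
    exact ⟨x, hx h0, mem_gridCube_floor hh x⟩
  have happ : ∀ U ∈ K, ‖U - gridStep q h S (fun k => gridMean h U k)‖ < ε / 2 := by
    intro U hU
    set ρ : ℝ := √d * h * M with hρ
    have h1 : ∀ z ∈ centredCube d h, ‖translate z U - U‖ₑ ≤ ENNReal.ofReal ρ := by
      intro z hz
      rw [← ofReal_norm]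
      refine ENNReal.ofReal_le_ofReal ((hT U hU z).trans ?_)
      exact mul_le_mul_of_nonneg_right (norm_le_of_mem_centredCube hh.le hz) hM
    have h2 := enorm_sub_gridStep_rpow_le hq hh U h1 (hSR U hU)
    have h3 : ‖U - gridStep q h S (fun k => gridMean h U k)‖ₑ ≤ 2 ^ d * ENNReal.ofReal ρ := by
      rw [← ENNReal.rpow_le_rpow_iff hp]
      refine h2.trans ?_
      rw [ENNReal.mul_rpow_of_nonneg _ _ hp.le]
      gcongr
      -- Since $q\ge1$, the factor `2 ^ d` is at most its own $q$-th power, which allows taking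
      -- $q$-th roots.
      have h4 : (1 : ℝ≥0∞) ≤ 2 ^ d := one_le_pow₀ one_le_two
      simpa using ENNReal.rpow_le_rpow_of_exponent_le h4 hp1
    have h5 : (2 ^ d * ENNReal.ofReal ρ : ℝ≥0∞) = ENNReal.ofReal (2 ^ d * ρ) := by
      rw [ENNReal.ofReal_mul (p := 2 ^ d) (by positivity), ENNReal.ofReal_pow zero_le_two,
        ENNReal.ofReal_ofNat]
    rw [h5, ← ofReal_norm, ENNReal.ofReal_le_ofReal_iff (by positivity)] at h3
    refine h3.trans_lt ?_
    have h6 : 2 ^ d * ρ = ε / 2 * (√d * M / (√d * M + 1)) := by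
      rw [hρ, hh_def]; field_simp
    rw [h6]
    refine mul_lt_of_lt_one_right (by positivity) ?_
    rw [div_lt_one (by positivity)]
    linarith
  obtain ⟨B, hB⟩ : ∃ B : ℝ, ∀ U ∈ K, ∀ k, |gridMean h U k| ≤ B := by
    set c : ℝ≥0∞ := ((ENNReal.ofReal h ^ d)⁻¹ * ENNReal.ofReal C ^ q.toReal) ^ (q.toReal)⁻¹ with hc
    have hct : c ≠ ⊤ := by
      refine ENNReal.rpow_ne_top_of_nonneg (inv_nonneg.2 hp.le) (ENNReal.mul_ne_top ?_ ?_)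
      · exact ENNReal.inv_ne_top.2 (pow_ne_zero _ (ENNReal.ofReal_pos.2 hh).ne')
      · exact ENNReal.rpow_ne_top_of_nonneg hp.le ENNReal.ofReal_ne_top
    refine ⟨c.toReal, fun U hU k => ?_⟩
    have h1 : ‖gridMean h U k‖ₑ ≤ c := by
      rw [hc, ENNReal.le_rpow_inv_iff hp]
      refine (enorm_gridMean_rpow_le hq hh U k).trans ?_
      gcongr
      rw [← ofReal_norm]
      exact ENNReal.ofReal_le_ofReal (hC U hU)
    rw [← Real.norm_eq_abs, ← toReal_enorm]
    exact ENNReal.toReal_mono hct h1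
  -- The approximating step functions have finitely many, uniformly bounded coefficients, so they
  -- lie in a continuous image of a compact box.
  have hcomp : IsCompact (gridStep q h S '' Set.univ.pi fun _ => Set.Icc (-B) B) :=
    (isCompact_univ_pi fun _ => isCompact_Icc).image (continuous_gridStep h S)
  obtain ⟨t, ht, hcover⟩ := Metric.totallyBounded_iff.1 hcomp.totallyBounded (ε / 2) (half_pos hε)
  refine ⟨t, ht, fun U hU => ?_⟩
  have hm : gridStep q h S (fun k => gridMean h U k) ∈
      gridStep q h S '' Set.univ.pi fun _ => Set.Icc (-B) B :=
    ⟨_, fun k _ => abs_le.1 (hB U hU k), rfl⟩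
  obtain ⟨y, hy, hUy⟩ := Set.mem_iUnion₂.1 (hcover hm)
  refine Set.mem_iUnion₂.2 ⟨y, hy, ?_⟩
  rw [Metric.mem_ball] at hUy ⊢
  have h7 := happ U hU
  rw [← dist_eq_norm] at h7
  linarith [dist_triangle U (gridStep q h S (fun k => gridMean h U k)) y]

/-! ### Quantitative convexity of the $q$-th power of the norm -/

section UniformConvexity

variable {E : Type*} [NormedAddCommGroup E] [NormedSpace ℝ E]

/-- If the norms agree, the space's strict convexity is responsible; if they differ, that of
$t\mapsto t^p$. -/
theorem norm_midpoint_rpow_lt [StrictConvexSpace ℝ E] {p : ℝ} (hp : 1 < p) {a b : E}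
    (hab : a ≠ b) : ‖(1 / 2 : ℝ) • (a + b)‖ ^ p < (‖a‖ ^ p + ‖b‖ ^ p) / 2 := by
  have hp0 : 0 < p := one_pos.trans hp
  by_cases h : ‖a‖ = ‖b‖
  · have h1 := (norm_midpoint_lt_iff h).2 hab
    have h2 := Real.rpow_lt_rpow (norm_nonneg _) h1 hp0
    rw [← h]; linarith
  · have h1 : ‖(1 / 2 : ℝ) • (a + b)‖ ≤ (1 / 2) * ‖a‖ + (1 / 2) * ‖b‖ := by
      rw [norm_smul, Real.norm_of_nonneg (by norm_num)]
      linarith [norm_add_le a b]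
    have h2 := (strictConvexOn_rpow hp).2 (norm_nonneg a) (norm_nonneg b) h
      (show (0 : ℝ) < 1 / 2 by norm_num) (show (0 : ℝ) < 1 / 2 by norm_num) (by norm_num)
    simp only [smul_eq_mul] at h2
    linarith [Real.rpow_le_rpow (norm_nonneg _) h1 hp0.le]

/-- Both sides are homogeneous of degree `p`, so $\|a\|^p+\|b\|^p=1$ may be assumed. Where
$\|a-b\|^p\ge\delta$ the midpoint defect is positive on a compact set, so its ratio to $\|a-b\|^p$
is controlled; elsewhere the `δ` term suffices. This form integrates directly to $L^q$. -/
theorem exists_norm_sub_rpow_le [StrictConvexSpace ℝ E] [FiniteDimensional ℝ E] {p : ℝ}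
    (hp : 1 < p) {δ : ℝ} (hδ : 0 < δ) :
    ∃ C : ℝ, ∀ a b : E, ‖a - b‖ ^ p ≤
      C * ((‖a‖ ^ p + ‖b‖ ^ p) / 2 - ‖(1 / 2 : ℝ) • (a + b)‖ ^ p) +
        δ * (‖a‖ ^ p + ‖b‖ ^ p) := by
  have hp0 : 0 < p := one_pos.trans hp
  have : ProperSpace E := FiniteDimensional.proper ℝ E
  have hcont : Continuous fun t : ℝ => t ^ p := Real.continuous_rpow_const hp0.le
  set D : E × E → ℝ := fun x => (‖x.1‖ ^ p + ‖x.2‖ ^ p) / 2 - ‖(1 / 2 : ℝ) • (x.1 + x.2)‖ ^ p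
    with hD
  have hDc : Continuous D := by
    have h1 : Continuous fun x : E × E => ‖x.1‖ ^ p := hcont.comp (by fun_prop)
    have h2 : Continuous fun x : E × E => ‖x.2‖ ^ p := hcont.comp (by fun_prop)
    have h3 : Continuous fun x : E × E => ‖(1 / 2 : ℝ) • (x.1 + x.2)‖ ^ p :=
      hcont.comp (by fun_prop)
    exact ((h1.add h2).div_const 2).sub h3
  have hDpos : ∀ a b : E, a ≠ b → 0 < D (a, b) := fun a b hab => by
    have := norm_midpoint_rpow_lt hp hab
    simp only [hD]; linarith
  have hDnn : ∀ a b : E, 0 ≤ D (a, b) := fun a b => by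
    by_cases hab : a = b
    · subst hab
      simp only [hD]
      rw [← two_smul ℝ a, smul_smul]; norm_num
    · exact (hDpos a b hab).le
  set K : Set (E × E) := {x | ‖x.1‖ ^ p + ‖x.2‖ ^ p = 1 ∧ δ ≤ ‖x.1 - x.2‖ ^ p} with hK
  have hKc : IsCompact K := by
    refine Metric.isCompact_of_isClosed_isBounded ?_ ?_
    · rw [hK, Set.ofPred_and]
      refine (isClosed_eq ?_ continuous_const).inter (isClosed_le continuous_const ?_)
      · exact (hcont.comp (by fun_prop : Continuous fun x : E × E => ‖x.1‖)).add
          (hcont.comp (by fun_prop : Continuous fun x : E × E => ‖x.2‖))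
      · exact hcont.comp (by fun_prop : Continuous fun x : E × E => ‖x.1 - x.2‖)
    · refine (Metric.isBounded_closedBall (x := (0 : E × E)) (r := 1)).subset ?_
      rintro ⟨a, b⟩ ⟨h1, -⟩
      simp only at h1
      have ha := Real.rpow_nonneg (norm_nonneg a) p
      have hb := Real.rpow_nonneg (norm_nonneg b) p
      rw [mem_closedBall_zero_iff, Prod.norm_def]
      refine max_le ?_ ?_
      · by_contra! h
        linarith [Real.one_lt_rpow h hp0]
      · by_contra! h
        linarith [Real.one_lt_rpow h hp0]
  have hne : ∀ x ∈ K, x.1 ≠ x.2 := by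
    rintro ⟨a, b⟩ ⟨-, h2⟩ (rfl : a = b)
    simp only [sub_self, norm_zero, Real.zero_rpow hp0.ne'] at h2
    linarith
  obtain ⟨C, hC⟩ : BddAbove ((fun x : E × E => ‖x.1 - x.2‖ ^ p / D x) '' K) := by
    refine (hKc.image_of_continuousOn (ContinuousOn.div ?_ hDc.continuousOn ?_)).bddAbove
    · exact (hcont.comp (by fun_prop : Continuous fun x : E × E => ‖x.1 - x.2‖)).continuousOn
    · exact fun x hx => (hDpos x.1 x.2 (hne x hx)).ne'
  have hunit : ∀ a b : E, ‖a‖ ^ p + ‖b‖ ^ p = 1 → ‖a - b‖ ^ p ≤ max C 0 * D (a, b) + δ := by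
    intro a b h
    by_cases hab : δ ≤ ‖a - b‖ ^ p
    · have hx : (a, b) ∈ K := ⟨h, hab⟩
      have h1 := hC (Set.mem_image_of_mem _ hx)
      simp only at h1
      rw [div_le_iff₀ (hDpos a b (hne _ hx))] at h1
      have := mul_le_mul_of_nonneg_right (le_max_left C 0) (hDnn a b)
      linarith
    · have := mul_nonneg (le_max_right C 0) (hDnn a b)
      linarith
  refine ⟨max C 0, fun a b => ?_⟩
  set s := ‖a‖ ^ p + ‖b‖ ^ p with hs
  have ha := Real.rpow_nonneg (norm_nonneg a) p
  have hb := Real.rpow_nonneg (norm_nonneg b) p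
  rcases (add_nonneg ha hb).eq_or_lt with h0 | h0
  · have ha0 : a = 0 := by
      have : ‖a‖ ^ p = 0 := by linarith
      rwa [Real.rpow_eq_zero (norm_nonneg _) hp0.ne', norm_eq_zero] at this
    have hb0 : b = 0 := by
      have : ‖b‖ ^ p = 0 := by linarith
      rwa [Real.rpow_eq_zero (norm_nonneg _) hp0.ne', norm_eq_zero] at this
    simp [hs, ha0, hb0, Real.zero_rpow hp0.ne']
  · change 0 < s at h0
    -- The scaling that normalises the sum of the $p$-th powers to one.
    set r : ℝ := s⁻¹ ^ p⁻¹ with hr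
    have hr0 : 0 ≤ r := Real.rpow_nonneg (inv_nonneg.2 h0.le) _
    have hrp : r ^ p = s⁻¹ := Real.rpow_inv_rpow (inv_nonneg.2 h0.le) hp0.ne'
    have hsc : ∀ x : E, ‖r • x‖ ^ p = s⁻¹ * ‖x‖ ^ p := fun x => by
      rw [norm_smul, Real.norm_of_nonneg hr0, Real.mul_rpow hr0 (norm_nonneg _), hrp]
    have h1 := hunit (r • a) (r • b) (by
      rw [hsc, hsc, ← mul_add]; exact inv_mul_cancel₀ h0.ne')
    simp only [hD] at h1
    rw [← smul_sub, ← smul_add, smul_comm (1 / 2 : ℝ) r, hsc, hsc, hsc, hsc] at h1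
    have h2 := mul_le_mul_of_nonneg_left h1 h0.le
    have h3 : s * (s⁻¹ * ‖a - b‖ ^ p) = ‖a - b‖ ^ p := by field_simp
    rw [h3] at h2
    refine h2.trans_eq ?_
    field_simp
    rw [hs]

variable {α : Type*} [MeasurableSpace α] {μ : Measure α}

theorem Lp_integrable_norm_rpow {E : Type*} [NormedAddCommGroup E] (hq0 : q ≠ 0) (hq : q ≠ ⊤)
    (f : Lp E q μ) : Integrable (fun x => ‖f x‖ ^ q.toReal) μ :=
  (Lp.memLp f).integrable_norm_rpow hq0 hq

theorem Lp_norm_rpow_eq_integral {E : Type*} [NormedAddCommGroup E] (hq0 : q ≠ 0) (hq : q ≠ ⊤)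
    (f : Lp E q μ) : ‖f‖ ^ q.toReal = ∫ x, ‖f x‖ ^ q.toReal ∂μ := by
  rw [integral_eq_lintegral_of_nonneg_ae
    (Eventually.of_forall fun x => Real.rpow_nonneg (norm_nonneg _) _)
    (Lp_integrable_norm_rpow hq0 hq f).1, Lp.norm_def, ENNReal.toReal_rpow, ← Lp.enorm_def,
    Lp_enorm_rpow_eq_lintegral hq0 hq]
  congr 1
  refine lintegral_congr fun x => ?_
  rw [← ENNReal.ofReal_rpow_of_nonneg (norm_nonneg _) ENNReal.toReal_nonneg, ofReal_norm]

theorem exists_Lp_norm_sub_rpow_le [StrictConvexSpace ℝ E] [FiniteDimensional ℝ E]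
    (hq1 : 1 < q) (hq : q ≠ ⊤) {δ : ℝ} (hδ : 0 < δ) :
    ∃ C : ℝ, ∀ f g : Lp E q μ, ‖f - g‖ ^ q.toReal ≤
      C * ((‖f‖ ^ q.toReal + ‖g‖ ^ q.toReal) / 2 - ‖(1 / 2 : ℝ) • (f + g)‖ ^ q.toReal) +
        δ * (‖f‖ ^ q.toReal + ‖g‖ ^ q.toReal) := by
  have hq0 : q ≠ 0 := (one_pos.trans hq1).ne'
  have hp : 1 < q.toReal := by simpa using (ENNReal.toReal_lt_toReal ENNReal.one_ne_top hq).2 hq1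
  obtain ⟨C, hC⟩ := exists_norm_sub_rpow_le (E := E) hp hδ
  refine ⟨C, fun f g => ?_⟩
  have hi := fun f : Lp E q μ => Lp_integrable_norm_rpow hq0 hq f
  have h1 : Integrable (fun x => (‖f x‖ ^ q.toReal + ‖g x‖ ^ q.toReal) / 2) μ :=
    ((hi f).add (hi g)).div_const 2
  have h2 : Integrable (fun x => C * ((‖f x‖ ^ q.toReal + ‖g x‖ ^ q.toReal) / 2 -
      ‖((1 / 2 : ℝ) • (f + g) : Lp E q μ) x‖ ^ q.toReal)) μ := (h1.sub (hi _)).const_mul C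
  have h3 : Integrable (fun x => δ * (‖f x‖ ^ q.toReal + ‖g x‖ ^ q.toReal)) μ :=
    ((hi f).add (hi g)).const_mul δ
  simp only [Lp_norm_rpow_eq_integral hq0 hq]
  rw [← integral_add (hi f) (hi g), ← integral_div, ← integral_sub h1 (hi _),
    ← integral_const_mul, ← integral_const_mul, ← integral_add h2 h3]
  refine integral_mono_ae (hi _) (h2.add h3) ?_
  filter_upwards [Lp.coeFn_sub f g, Lp.coeFn_add f g, Lp.coeFn_smul (1 / 2 : ℝ) (f + g)]
    with x h1 h2 h3
  simp only [h1, h2, h3, Pi.sub_apply, Pi.add_apply, Pi.smul_apply]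
  exact hC _ _

/-- A sequence in `L^q`, `1 < q < ∞`, is Cauchy if its norms converge to `m` and the norms of the
midpoints of its pairs of members are asymptotically at least `m`. -/
theorem cauchySeq_of_norm_midpoint [StrictConvexSpace ℝ E] [FiniteDimensional ℝ E] [Fact (1 ≤ q)]
    (hq1 : 1 < q) (hq : q ≠ ⊤) {G : ℕ → Lp E q μ} {m : ℝ} {b : ℕ × ℕ → ℝ}
    (hG : Tendsto (fun n => ‖G n‖) atTop (𝓝 m)) (hb : Tendsto b atTop (𝓝 m))
    (hbG : ∀ n, b n ≤ ‖(1 / 2 : ℝ) • (G n.1 + G n.2)‖) : CauchySeq G := by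
  have hq0 : q ≠ 0 := (one_pos.trans hq1).ne'
  have hp : 0 < q.toReal := ENNReal.toReal_pos hq0 hq
  have hm : 0 ≤ m := ge_of_tendsto' hG fun n => norm_nonneg _
  have hmp : 0 ≤ m ^ q.toReal := Real.rpow_nonneg hm _
  have h1 : Tendsto (fun n : ℕ × ℕ => ‖G n.1‖) atTop (𝓝 m) := by
    rw [← prod_atTop_atTop_eq]; exact hG.comp tendsto_fst
  have h2 : Tendsto (fun n : ℕ × ℕ => ‖G n.2‖) atTop (𝓝 m) := by
    rw [← prod_atTop_atTop_eq]; exact hG.comp tendsto_snd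
  have h3 : Tendsto (fun n : ℕ × ℕ => ‖(1 / 2 : ℝ) • (G n.1 + G n.2)‖) atTop (𝓝 m) := by
    refine tendsto_of_tendsto_of_tendsto_of_le_of_le hb
      (h := fun n : ℕ × ℕ => (‖G n.1‖ + ‖G n.2‖) / 2) ?_ hbG fun n => ?_
    · simpa using (h1.add h2).div_const 2
    · change ‖(1 / 2 : ℝ) • (G n.1 + G n.2)‖ ≤ _
      rw [norm_smul, Real.norm_of_nonneg (by norm_num)]
      linarith [norm_add_le (G n.1) (G n.2)]
  have hpow : ∀ {f : ℕ × ℕ → ℝ}, Tendsto f atTop (𝓝 m) →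
      Tendsto (fun n => f n ^ q.toReal) atTop (𝓝 (m ^ q.toReal)) := fun hf =>
    ((Real.continuous_rpow_const hp.le).tendsto m).comp hf
  rw [cauchySeq_iff_tendsto_dist_atTop_0, Metric.tendsto_nhds]
  intro ε hε
  have hεp : 0 < ε ^ q.toReal := Real.rpow_pos_of_pos hε _
  -- In the limit the midpoint defect vanishes and only `2 * δ * m ^ q.toReal` survives, which this
  -- choice puts below `ε ^ q.toReal` even for `m = 0`.
  set δ := ε ^ q.toReal / (2 * m ^ q.toReal + 1) with hδ
  obtain ⟨C, hC⟩ := exists_Lp_norm_sub_rpow_le (E := E) (μ := μ) hq1 hq (δ := δ) (by positivity)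
  have h4 := (((((hpow h1).add (hpow h2)).div_const 2).sub (hpow h3)).const_mul C).add
    (((hpow h1).add (hpow h2)).const_mul δ)
  have h5 : C * ((m ^ q.toReal + m ^ q.toReal) / 2 - m ^ q.toReal) +
      δ * (m ^ q.toReal + m ^ q.toReal) < ε ^ q.toReal := by
    have : δ * (2 * m ^ q.toReal + 1) = ε ^ q.toReal := by rw [hδ]; field_simp
    have hδ0 : 0 < δ := by positivity
    linarith
  filter_upwards [h4.eventually (gt_mem_nhds h5)] with n hn
  rw [Real.dist_eq, sub_zero, abs_of_nonneg dist_nonneg, dist_eq_norm]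
  exact (Real.rpow_lt_rpow_iff (norm_nonneg _) hε.le hp).1 ((hC _ _).trans_lt hn)

end UniformConvexity

/-! ### Linearity and closedness of the weak gradient; existence of minimizers -/

theorem HasWeakGradient.smul {u : EuclideanSpace ℝ (Fin d) → ℝ}
    {g : EuclideanSpace ℝ (Fin d) → EuclideanSpace ℝ (Fin d)} (h : HasWeakGradient u g) (c : ℝ) :
    HasWeakGradient (c • u) (c • g) where
  locallyIntegrable := h.locallyIntegrable.smul c
  locallyIntegrable_grad := h.locallyIntegrable_grad.smul c
  integral_eq φ hφ hφc v := by
    simp only [Pi.smul_apply, smul_eq_mul, real_inner_smul_left, mul_assoc, integral_const_mul]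
    rw [h.integral_eq φ hφ hφc v, mul_neg]

theorem LocallyIntegrable.integrable_mul {u φ : EuclideanSpace ℝ (Fin d) → ℝ}
    (hu : LocallyIntegrable u volume) (hφ : Continuous φ) (hφc : HasCompactSupport φ) :
    Integrable (fun x => u x * φ x) volume := by
  simpa [mul_comm] using hu.integrable_smul_left_of_hasCompactSupport hφ hφc

theorem continuous_fderiv_apply {φ : EuclideanSpace ℝ (Fin d) → ℝ} (hφ : ContDiff ℝ ∞ φ)
    (v : EuclideanSpace ℝ (Fin d)) : Continuous fun x => fderiv ℝ φ x v :=
  (hφ.continuous_fderiv (by simp)).clm_apply continuous_const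

theorem hasCompactSupport_fderiv_apply {φ : EuclideanSpace ℝ (Fin d) → ℝ}
    (hφc : HasCompactSupport φ) (v : EuclideanSpace ℝ (Fin d)) :
    HasCompactSupport fun x => fderiv ℝ φ x v :=
  hφc.fderiv_apply ℝ v

theorem HasWeakGradient.add {u u' : EuclideanSpace ℝ (Fin d) → ℝ}
    {g g' : EuclideanSpace ℝ (Fin d) → EuclideanSpace ℝ (Fin d)} (h : HasWeakGradient u g)
    (h' : HasWeakGradient u' g') : HasWeakGradient (u + u') (g + g') where
  locallyIntegrable := h.locallyIntegrable.add h'.locallyIntegrable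
  locallyIntegrable_grad := h.locallyIntegrable_grad.add h'.locallyIntegrable_grad
  integral_eq φ hφ hφc v := by
    have hd := continuous_fderiv_apply hφ v
    have hdc := hasCompactSupport_fderiv_apply hφc v
    have hi := fun {g : EuclideanSpace ℝ (Fin d) → EuclideanSpace ℝ (Fin d)}
      (hg : LocallyIntegrable g volume) =>
      LocallyIntegrable.integrable_mul (LocallyIntegrable.inner_const hg v) hφ.continuous hφc
    simp only [Pi.add_apply, inner_add_left, add_mul]
    rw [integral_add (LocallyIntegrable.integrable_mul h.locallyIntegrable hd hdc)
      (LocallyIntegrable.integrable_mul h'.locallyIntegrable hd hdc),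
      integral_add (hi h.locallyIntegrable_grad) (hi h'.locallyIntegrable_grad),
      h.integral_eq φ hφ hφc v, h'.integral_eq φ hφ hφc v, neg_add]

section Lp

variable {U U' : Lp ℝ q (volume : Measure (EuclideanSpace ℝ (Fin d)))}
  {G G' : Lp (EuclideanSpace ℝ (Fin d)) q (volume : Measure (EuclideanSpace ℝ (Fin d)))}

theorem HasWeakGradient.Lp_smul (h : HasWeakGradient U G) (c : ℝ) :
    HasWeakGradient (c • U : Lp ℝ q _) (c • G : Lp (EuclideanSpace ℝ (Fin d)) q _) :=
  (h.smul c).congr (Lp.coeFn_smul c U).symm (Lp.coeFn_smul c G).symm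

theorem HasWeakGradient.Lp_add (h : HasWeakGradient U G) (h' : HasWeakGradient U' G') :
    HasWeakGradient (U + U' : Lp ℝ q _) (G + G' : Lp (EuclideanSpace ℝ (Fin d)) q _) :=
  (h.add h').congr (Lp.coeFn_add U U').symm (Lp.coeFn_add G G').symm

/-- For a fixed test function both sides of the defining identity are continuous linear functionals
on $L^q$. -/
theorem HasWeakGradient.of_tendsto [Fact (1 ≤ q)]
    {Us : ℕ → Lp ℝ q (volume : Measure (EuclideanSpace ℝ (Fin d)))}
    {Gs : ℕ → Lp (EuclideanSpace ℝ (Fin d)) q (volume : Measure (EuclideanSpace ℝ (Fin d)))}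
    (h : ∀ n, HasWeakGradient (Us n) (Gs n)) (hU : Tendsto Us atTop (𝓝 U))
    (hG : Tendsto Gs atTop (𝓝 G)) : HasWeakGradient U G where
  locallyIntegrable := locallyIntegrable_Lp U
  locallyIntegrable_grad := locallyIntegrable_Lp G
  integral_eq φ hφ hφc v := by
    obtain ⟨T, hT⟩ := exists_pairing (q := q) (continuous_fderiv_apply hφ v)
      (hasCompactSupport_fderiv_apply hφc v)
    obtain ⟨T', hT'⟩ := exists_pairing (q := q) hφ.continuous hφc
    have h1 : Tendsto (fun n => T (Us n)) atTop (𝓝 (T U)) := (T.continuous.tendsto U).comp hU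
    have h2 : Tendsto (fun n => T' (innerLp v (Gs n))) atTop (𝓝 (T' (innerLp v G))) :=
      (((T'.comp ((innerSL ℝ v).compLpL q volume)).continuous).tendsto G).comp hG
    have h3 : ∀ n, T (Us n) = -T' (innerLp v (Gs n)) := fun n => by
      rw [hT, hT', (h n).integral_innerLp v φ hφ hφc]
    have h4 : T U = -T' (innerLp v G) :=
      tendsto_nhds_unique h1 (by simpa only [h3] using h2.neg)
    rw [hT, hT'] at h4
    rw [h4]
    congr 1
    apply integral_congr_ae
    filter_upwards [coeFn_innerLp v G] with x hx
    rw [hx]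

theorem Lp_ae_eq_zero_of_tendsto {α E : Type*} [MeasurableSpace α] {μ : Measure α}
    [NormedAddCommGroup E] [Fact (1 ≤ q)] {f : ℕ → Lp E q μ} {f₀ : Lp E q μ}
    (h : Tendsto f atTop (𝓝 f₀)) {P : α → Prop} (hf : ∀ n, ∀ᵐ x ∂μ, P x → f n x = 0) :
    ∀ᵐ x ∂μ, P x → f₀ x = 0 := by
  obtain ⟨ns, -, hns⟩ := (tendstoInMeasure_of_tendsto_Lp h).exists_seq_tendsto_ae
  filter_upwards [hns, ae_all_iff.2 hf] with x h1 h2 hP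
  refine tendsto_nhds_unique h1 ?_
  simp only [h2 _ hP, tendsto_const_nhds]

end Lp

/-- The pairs `(U, ∇U)` with `U ∈ W^{1,q}(ℝ^d)` and `U = 0` a.e. outside `F`. -/
def sobolevPairs (q : ℝ≥0∞) (F : Set (EuclideanSpace ℝ (Fin d))) :
    Set (Lp ℝ q (volume : Measure (EuclideanSpace ℝ (Fin d))) ×
      Lp (EuclideanSpace ℝ (Fin d)) q (volume : Measure (EuclideanSpace ℝ (Fin d)))) :=
  {W | HasWeakGradient W.1 W.2 ∧ ∀ᵐ x, x ∉ F → W.1 x = 0}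

theorem smul_mem_sobolevPairs {F : Set (EuclideanSpace ℝ (Fin d))}
    {W : Lp ℝ q (volume : Measure (EuclideanSpace ℝ (Fin d))) ×
      Lp (EuclideanSpace ℝ (Fin d)) q (volume : Measure (EuclideanSpace ℝ (Fin d)))}
    (hW : W ∈ sobolevPairs q F) (c : ℝ) : (c • W.1, c • W.2) ∈ sobolevPairs q F := by
  refine ⟨hW.1.Lp_smul c, ?_⟩
  filter_upwards [hW.2, Lp.coeFn_smul c W.1] with x h1 h2 hx
  simp only [h2, Pi.smul_apply, h1 hx, smul_zero]

theorem add_mem_sobolevPairs {F : Set (EuclideanSpace ℝ (Fin d))}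
    {W W' : Lp ℝ q (volume : Measure (EuclideanSpace ℝ (Fin d))) ×
      Lp (EuclideanSpace ℝ (Fin d)) q (volume : Measure (EuclideanSpace ℝ (Fin d)))}
    (hW : W ∈ sobolevPairs q F) (hW' : W' ∈ sobolevPairs q F) :
    (W.1 + W'.1, W.2 + W'.2) ∈ sobolevPairs q F := by
  refine ⟨hW.1.Lp_add hW'.1, ?_⟩
  filter_upwards [hW.2, hW'.2, Lp.coeFn_add W.1 W'.1] with x h1 h2 h3 hx
  simp only [h3, Pi.add_apply, h1 hx, h2 hx, add_zero]

/-- The direct method without weak topologies: bounded gradients give compactness of the functions,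
and near-optimality of midpoints upgrades this to strong convergence of the gradients. -/
theorem exists_minimizer [Fact (1 ≤ q)] (hq1 : 1 < q) (hq : q ≠ ⊤)
    {F : Set (EuclideanSpace ℝ (Fin d))} {R : ℝ}
    (hF : ∀ᵐ x, x ∈ F → x ∈ Metric.closedBall (0 : EuclideanSpace ℝ (Fin d)) R)
    (hne : ∃ W ∈ sobolevPairs q F, ‖W.1‖ = 1) :
    ∃ W ∈ sobolevPairs q F, ‖W.1‖ = 1 ∧ ∀ W' ∈ sobolevPairs q F, ‖W'.1‖ = 1 → ‖W.2‖ ≤ ‖W'.2‖ := by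
  set A : Set ℝ := (fun W => ‖W.2‖) '' {W | W ∈ sobolevPairs q F ∧ ‖W.1‖ = 1} with hA
  have hAne : A.Nonempty := by
    obtain ⟨W, h1, h2⟩ := hne
    exact ⟨_, W, ⟨h1, h2⟩, rfl⟩
  have hAbdd : BddBelow A := ⟨0, by rintro _ ⟨W, -, rfl⟩; exact norm_nonneg _⟩
  set m := sInf A with hm
  -- The homogeneous form of minimality applies to midpoints, which need not have norm one.
  have hmle : ∀ W ∈ sobolevPairs q F, m * ‖W.1‖ ≤ ‖W.2‖ := by
    intro W hW
    rcases (norm_nonneg W.1).eq_or_lt with h0 | h0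
    · rw [← h0, mul_zero]; exact norm_nonneg _
    · have h1 : m ≤ ‖‖W.1‖⁻¹ • W.2‖ := csInf_le hAbdd
        ⟨_, ⟨smul_mem_sobolevPairs hW ‖W.1‖⁻¹, by simp [norm_smul, h0.ne']⟩, rfl⟩
      rwa [norm_smul, norm_inv, norm_norm, inv_mul_eq_div, le_div_iff₀ h0] at h1
  obtain ⟨a, -, ha, haA⟩ := exists_seq_tendsto_sInf hAne hAbdd
  choose W hW hWa using haA
  have hWm : Tendsto (fun n => ‖(W n).2‖) atTop (𝓝 m) := by simpa only [hWa] using ha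
  obtain ⟨M, hM⟩ := hWm.bddAbove_range
  have hM' : ∀ n, ‖(W n).2‖ ≤ M := fun n => hM ⟨n, rfl⟩
  have htb : TotallyBounded (Set.range fun n => (W n).1) := by
    refine totallyBounded_of_norm_translate_sub_le hq (R := R) (C := 1) (M := M)
      ((norm_nonneg _).trans (hM' 0)) ?_ ?_ ?_
    · rintro _ ⟨n, rfl⟩; exact (hW n).2.le
    · rintro _ ⟨n, rfl⟩ z
      exact ((hW n).1.1.norm_translate_sub_le hq z).trans
        (mul_le_mul_of_nonneg_left (hM' n) (norm_nonneg _))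
    · rintro _ ⟨n, rfl⟩
      filter_upwards [hF, (hW n).1.2] with x h1 h2 h3
      refine h1 ?_
      by_contra h4
      exact h3 (h2 h4)
  have hcomp : IsCompact (closure (Set.range fun n => (W n).1)) :=
    isCompact_iff_totallyBounded_isComplete.2 ⟨htb.closure, isClosed_closure.isComplete⟩
  obtain ⟨U, -, ns, hns, hU⟩ := hcomp.tendsto_subseq
    (x := fun n => (W n).1) fun n => subset_closure ⟨n, rfl⟩
  have hU1 : ‖U‖ = 1 := by
    refine tendsto_nhds_unique hU.norm ?_
    simp only [Function.comp, (hW _).2, tendsto_const_nhds]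
  have hcauchy : CauchySeq fun n => (W (ns n)).2 := by
    refine cauchySeq_of_norm_midpoint hq1 hq (m := m)
      -- The midpoints of the functions converge to `U`, of norm one, so this lower bound tends to
      -- `m`.
      (b := fun n => m * ‖(1 / 2 : ℝ) • ((W (ns n.1)).1 + (W (ns n.2)).1)‖)
      (hWm.comp hns.tendsto_atTop) ?_ fun n => ?_
    · have h1 : Tendsto (fun n : ℕ × ℕ => (W (ns n.1)).1) atTop (𝓝 U) := by
        rw [← prod_atTop_atTop_eq]; exact hU.comp tendsto_fst
      have h2 : Tendsto (fun n : ℕ × ℕ => (W (ns n.2)).1) atTop (𝓝 U) := by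
        rw [← prod_atTop_atTop_eq]; exact hU.comp tendsto_snd
      have h3 := (((h1.add h2).const_smul (1 / 2 : ℝ)).norm).const_mul m
      have h4 : (1 / 2 : ℝ) • (U + U) = U := by rw [← two_smul ℝ U, smul_smul]; norm_num
      rwa [h4, hU1, mul_one] at h3
    · have h5 := smul_mem_sobolevPairs
        (add_mem_sobolevPairs (hW (ns n.1)).1 (hW (ns n.2)).1) (1 / 2 : ℝ)
      have h6 := hmle _ h5
      dsimp only at h6
      exact h6
  obtain ⟨G, hG⟩ := cauchySeq_tendsto_of_complete hcauchy
  refine ⟨(U, G), ⟨HasWeakGradient.of_tendsto (fun n => (hW (ns n)).1.1) hU hG,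
    Lp_ae_eq_zero_of_tendsto hU fun n => (hW (ns n)).1.2⟩, hU1, fun W' hW' h1 => ?_⟩
  have h2 : ‖G‖ = m := tendsto_nhds_unique hG.norm (hWm.comp hns.tendsto_atTop)
  have h3 := hmle W' hW'
  rw [h1, mul_one] at h3
  exact h2.trans_le h3

/-! ### First eigenfunctions -/

variable {N : ℕ} {p : ℝ}

theorem toReal_ofReal_of_one_lt (hp : 1 < p) : (ENNReal.ofReal p).toReal = p :=
  ENNReal.toReal_ofReal (one_pos.trans hp).le

theorem fact_one_le_ofReal (hp : 1 < p) : Fact (1 ≤ ENNReal.ofReal p) :=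
  ⟨ENNReal.one_le_ofReal.2 hp.le⟩

theorem ofReal_ne_zero_of_one_lt (hp : 1 < p) : ENNReal.ofReal p ≠ 0 :=
  (ENNReal.ofReal_pos.2 (one_pos.trans hp)).ne'

/-- The energy over `F` is the full gradient energy because the gradient vanishes a.e. where `u`
does, in particular off `F`. -/
theorem MemW1p0.exists_sobolevPair (hp : 1 < p) {F : Set (EuclideanSpace ℝ (Fin d))}
    (hF : NullMeasurableSet F volume) {u : EuclideanSpace ℝ (Fin d) → ℝ} (hu : MemW1p0 p F u)
    (h1 : eLpNorm u (ENNReal.ofReal p) volume = 1) :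
    ∃ W ∈ sobolevPairs (ENNReal.ofReal p) F, ‖W.1‖ = 1 ∧
      ‖W.2‖ₑ ^ p = ∫⁻ x in F, ‖weakGrad u x‖ₑ ^ p := by
  have := fact_one_le_ofReal hp
  have hm := hu.1.1
  have hg := hu.1.memLp_weakGrad
  have hW : HasWeakGradient (hm.toLp u) (hg.toLp (weakGrad u)) :=
    hu.1.hasWeakGradient.congr hm.coeFn_toLp.symm hg.coeFn_toLp.symm
  refine ⟨(hm.toLp u, hg.toLp (weakGrad u)), ⟨hW, ?_⟩, ?_, ?_⟩
  · filter_upwards [hu.2, hm.coeFn_toLp] with x h2 h3 hx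
    rw [h3, h2 hx]
  · rw [Lp.norm_toLp, h1, ENNReal.toReal_one]
  · have h4 := Lp_enorm_rpow_eq_lintegral (ofReal_ne_zero_of_one_lt hp) ENNReal.ofReal_ne_top
      (hg.toLp (weakGrad u))
    rw [toReal_ofReal_of_one_lt hp] at h4
    rw [h4, ← lintegral_indicator₀ hF]
    apply lintegral_congr_ae
    filter_upwards [hu.2, hm.coeFn_toLp, hg.coeFn_toLp, hW.ae_eq_zero ENNReal.ofReal_ne_top]
      with x h5 h6 h7 h8
    by_cases hx : x ∈ F
    · rw [Set.indicator_of_mem hx, h7]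
    · rw [Set.indicator_of_notMem hx, h8 (by rw [h6, h5 hx]), enorm_zero,
        ENNReal.zero_rpow_of_pos (one_pos.trans hp)]

/-- Multiplying the gradient by the sign loses nothing: the sign is $\pm1$ where the function is
nonzero, and elsewhere the gradient is already zero a.e. -/
theorem memW1p0_abs_of_mem_sobolevPairs (hp : 1 < p) {F : Set (EuclideanSpace ℝ (Fin d))}
    {W : Lp ℝ (ENNReal.ofReal p) (volume : Measure (EuclideanSpace ℝ (Fin d))) ×
      Lp (EuclideanSpace ℝ (Fin d)) (ENNReal.ofReal p)
        (volume : Measure (EuclideanSpace ℝ (Fin d)))}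
    (hW : W ∈ sobolevPairs (ENNReal.ofReal p) F) :
    MemW1p0 p F (fun x => |W.1 x|) ∧
      ∫⁻ x, ‖weakGrad (fun x => |W.1 x|) x‖ₑ ^ p = ‖W.2‖ₑ ^ p := by
  have := fact_one_le_ofReal hp
  have hg := hW.1.abs ENNReal.ofReal_ne_top
  have hnorm : ∀ᵐ x, ‖(SignType.sign (W.1 x) : ℝ) • W.2 x‖ = ‖W.2 x‖ := by
    filter_upwards [hW.1.ae_eq_zero ENNReal.ofReal_ne_top] with x hx
    rcases lt_trichotomy (W.1 x) 0 with h | h | h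
    · simp [sign_neg h]
    · simp [hx h]
    · simp [sign_pos h]
  refine ⟨⟨⟨(Lp.memLp W.1).norm, _, hg, (Lp.memLp W.2).congr_norm
    hg.locallyIntegrable_grad.aestronglyMeasurable (hnorm.mono fun x hx => hx.symm)⟩, ?_⟩, ?_⟩
  · filter_upwards [hW.2] with x hx hxF
    rw [hx hxF, abs_zero]
  · have h4 := Lp_enorm_rpow_eq_lintegral (ofReal_ne_zero_of_one_lt hp) ENNReal.ofReal_ne_top W.2
    rw [toReal_ofReal_of_one_lt hp] at h4
    rw [h4]
    apply lintegral_congr_ae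
    filter_upwards [hg.weakGrad_ae_eq, hnorm] with x h5 h6
    rw [h5, ← ofReal_norm, h6, ofReal_norm]

theorem firstEigenvalue_le {F : Set (EuclideanSpace ℝ (Fin d))}
    {u : EuclideanSpace ℝ (Fin d) → ℝ} (hu : MemW1p0 p F u)
    (h1 : eLpNorm u (ENNReal.ofReal p) volume = 1) :
    firstEigenvalue p F ≤ ∫⁻ x in F, ‖weakGrad u x‖ₑ ^ p :=
  iInf_le_of_le u (iInf₂_le hu h1)

/-- The first eigenvalue of an essentially bounded set is attained by a nonnegative function. -/
theorem exists_firstEigenfunction (hp : 1 < p) {F : Set (EuclideanSpace ℝ (Fin d))}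
    (hF : NullMeasurableSet F volume) {R : ℝ}
    (hFR : ∀ᵐ x, x ∈ F → x ∈ Metric.closedBall (0 : EuclideanSpace ℝ (Fin d)) R)
    (hfin : firstEigenvalue p F ≠ ⊤) :
    ∃ u : EuclideanSpace ℝ (Fin d) → ℝ, MemW1p0 p F u ∧ (∀ x, 0 ≤ u x) ∧
      eLpNorm u (ENNReal.ofReal p) volume = 1 ∧
      ∫⁻ x, ‖weakGrad u x‖ₑ ^ p = firstEigenvalue p F := by
  have := fact_one_le_ofReal hp
  have hne : ∃ W ∈ sobolevPairs (ENNReal.ofReal p) F, ‖W.1‖ = 1 := by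
    by_contra! hcon
    refine hfin ?_
    simp only [firstEigenvalue, iInf_eq_top]
    intro u hu h1
    obtain ⟨W, hW, hW1, -⟩ := hu.exists_sobolevPair hp hF h1
    exact absurd hW1 (hcon W hW)
  obtain ⟨W, hW, hW1, hmin⟩ := exists_minimizer
    (by rw [← ENNReal.ofReal_one]; exact (ENNReal.ofReal_lt_ofReal_iff (one_pos.trans hp)).2 hp)
    ENNReal.ofReal_ne_top hFR hne
  obtain ⟨hmem, hE⟩ := memW1p0_abs_of_mem_sobolevPairs hp hW
  have hn : eLpNorm (fun x => |W.1 x|) (ENNReal.ofReal p) volume = 1 := by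
    have h2 : eLpNorm (fun x => |W.1 x|) (ENNReal.ofReal p) volume =
      eLpNorm W.1 (ENNReal.ofReal p) volume := eLpNorm_norm W.1
    rw [h2, ← Lp.enorm_def, ← ofReal_norm, hW1, ENNReal.ofReal_one]
  refine ⟨_, hmem, fun x => abs_nonneg _, hn, le_antisymm ?_ ?_⟩
  · rw [hE]
    refine le_iInf fun u => le_iInf₂ fun hu h1 => ?_
    obtain ⟨W', hW', h1', h2'⟩ := hu.exists_sobolevPair hp hF h1
    rw [← h2', ← ofReal_norm, ← ofReal_norm]
    exact ENNReal.rpow_le_rpow (ENNReal.ofReal_le_ofReal (hmin W' hW' h1')) (one_pos.trans hp).le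
  · exact (firstEigenvalue_le hmem hn).trans (setLIntegral_le_lintegral _ _)

/-! ### Passing between $N$-sets and $(p,N)$-functions -/

theorem IsNSet.exists_isPNFunction (hp : 1 < p) {Ω : Set (EuclideanSpace ℝ (Fin d))}
    (hbdd : Bornology.IsBounded Ω) {E : Fin N → Set (EuclideanSpace ℝ (Fin d))}
    (hE : IsNSet Ω E) (hfin : ∀ i, firstEigenvalue p (E i) ≠ ⊤) :
    ∃ u : Fin N → EuclideanSpace ℝ (Fin d) → ℝ, IsPNFunction p Ω u ∧
      gradEnergy p u = (fun i => firstEigenvalue p (E i)) ∧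
      ∀ i, volume ({x | 0 < u i x} \ E i) = 0 := by
  obtain ⟨R, hR⟩ := hbdd.subset_closedBall (0 : EuclideanSpace ℝ (Fin d))
  have hsub : ∀ i, ∀ᵐ x, x ∈ E i → x ∈ Ω := fun i => by
    have := hE.subset i
    rw [measure_eq_zero_iff_ae_notMem] at this
    filter_upwards [this] with x hx h1
    by_contra h2
    exact hx ⟨h1, h2⟩
  choose u hu hu0 hu1 huE using fun i => exists_firstEigenfunction hp (hE.measurable i)
    ((hsub i).mono fun x hx h => hR (hx h)) (hfin i)
  refine ⟨u, ⟨fun i => ⟨(hu i).1, ?_⟩, fun i => Eventually.of_forall (hu0 i), hu1, ?_⟩,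
    funext huE, fun i => ?_⟩
  · filter_upwards [(hu i).2, hsub i] with x h1 h2 h3
    exact h1 fun h4 => h3 (h2 h4)
  · intro i j hij
    have := hE.disjoint i j hij
    rw [measure_eq_zero_iff_ae_notMem] at this
    filter_upwards [this, (hu i).2, (hu j).2] with x h1 h2 h3 _
    by_cases hx : x ∈ E i
    · rw [h3 fun h => h1 ⟨hx, h⟩, mul_zero]
    · rw [h2 hx, zero_mul]
  · rw [measure_eq_zero_iff_ae_notMem]
    filter_upwards [(hu i).2] with x h1 h2
    have h3 : 0 < u i x := h2.1
    rw [h1 h2.2] at h3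
    exact lt_irrefl _ h3

theorem IsPNFunction.isNSet {Ω : Set (EuclideanSpace ℝ (Fin d))}
    {u : Fin N → EuclideanSpace ℝ (Fin d) → ℝ} (hu : IsPNFunction p Ω u) :
    IsNSet Ω (fun i => {x | 0 < u i x}) where
  measurable i := nullMeasurableSet_lt aemeasurable_const
    (hu.mem i).1.1.aestronglyMeasurable.aemeasurable
  subset i := by
    rw [measure_eq_zero_iff_ae_notMem]
    filter_upwards [(hu.mem i).2] with x h1 h2
    have h3 : 0 < u i x := h2.1
    rw [h1 h2.2] at h3
    exact lt_irrefl _ h3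
  pos i := by
    rw [pos_iff_ne_zero]
    intro h0
    rw [measure_eq_zero_iff_ae_notMem] at h0
    have h1 : u i =ᵐ[volume] 0 := by
      filter_upwards [h0, hu.nonneg i] with x h2 h3
      exact le_antisymm (not_lt.1 h2) h3
    have h2 := hu.norm_eq_one i
    rw [eLpNorm_congr_ae h1, eLpNorm_zero] at h2
    exact zero_ne_one h2
  disjoint i j hij := by
    rw [measure_eq_zero_iff_ae_notMem]
    filter_upwards [hu.disjoint i j hij, (hu.mem i).2] with x h1 h2 h3
    have hi : 0 < u i x := h3.1
    have hj : 0 < u j x := h3.2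
    -- The product condition is only given on `Ω`; outside, `u i` already vanishes a.e.
    by_cases hx : x ∈ Ω
    · exact (mul_pos hi hj).ne' (h1 hx)
    · exact hi.ne' (h2 hx)

theorem IsPNFunction.firstEigenvalue_le_gradEnergy {Ω : Set (EuclideanSpace ℝ (Fin d))}
    {u : Fin N → EuclideanSpace ℝ (Fin d) → ℝ} (hu : IsPNFunction p Ω u) (i : Fin N) :
    firstEigenvalue p {x | 0 < u i x} ≤ gradEnergy p u i := by
  have hmem : MemW1p0 p {x | 0 < u i x} (u i) := by
    refine ⟨(hu.mem i).1, ?_⟩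
    filter_upwards [hu.nonneg i] with x h1 h2
    exact le_antisymm (not_lt.1 h2) h1
  exact (firstEigenvalue_le hmem (hu.norm_eq_one i)).trans (setLIntegral_le_lintegral _ _)

theorem evalRef_mono {Φ : (Fin N → ℝ≥0) → ℝ≥0} (hΦ : Monotone Φ) : Monotone (evalRef Φ) := by
  intro v w hvw
  unfold evalRef
  by_cases hw : ∀ i, w i ≠ ⊤
  · have hv : ∀ i, v i ≠ ⊤ := fun i => ne_top_of_le_ne_top (hw i) (hvw i)
    rw [if_pos hw, if_pos hv]
    exact ENNReal.coe_le_coe.2 (hΦ fun i => ENNReal.toNNReal_mono (hw i) (hvw i))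
  · rw [if_neg hw]
    exact le_top

theorem evalRef_ne_top_iff {Φ : (Fin N → ℝ≥0) → ℝ≥0} {v : Fin N → ℝ≥0∞} :
    evalRef Φ v ≠ ⊤ ↔ ∀ i, v i ≠ ⊤ := by
  unfold evalRef
  split_ifs with h <;> simp [h]

/-! ### Finiteness of the functional eigenvalue -/

theorem MemW1p.lintegral_weakGrad_ne_top (hp : 1 < p) {u : EuclideanSpace ℝ (Fin d) → ℝ}
    (hu : MemW1p p u) : ∫⁻ x, ‖weakGrad u x‖ₑ ^ p ≠ ⊤ := by
  have h := lintegral_rpow_enorm_lt_top_of_eLpNorm_lt_top (ofReal_ne_zero_of_one_lt hp)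
    ENNReal.ofReal_ne_top hu.memLp_weakGrad.2
  rw [toReal_ofReal_of_one_lt hp] at h
  exact h.ne

theorem hasWeakGradient_of_contDiff {f : EuclideanSpace ℝ (Fin d) → ℝ} (hf : ContDiff ℝ ∞ f) :
    HasWeakGradient f (gradient f) where
  locallyIntegrable := hf.continuous.locallyIntegrable
  locallyIntegrable_grad := by
    refine Continuous.locallyIntegrable ?_
    exact (InnerProductSpace.toDual ℝ _).symm.continuous.comp (hf.continuous_fderiv (by simp))
  integral_eq φ hφ hφc v := by
    have h1 : Continuous fun x => fderiv ℝ f x v := continuous_fderiv_apply hf v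
    have h2 : ∀ x, inner ℝ (gradient f x) v = fderiv ℝ f x v := fun x => by
      rw [gradient, InnerProductSpace.toDual_symm_apply]
    simp only [h2]
    refine integral_mul_fderiv_eq_neg_fderiv_mul_of_integrable ?_ ?_ ?_
      (fun x _ => hf.differentiable (by simp) x) (fun x _ => hφ.differentiable (by simp) x)
    · exact (h1.mul hφ.continuous).integrable_of_hasCompactSupport hφc.mul_left
    · exact (hf.continuous.mul (continuous_fderiv_apply hφ v)).integrable_of_hasCompactSupport
        (hasCompactSupport_fderiv_apply hφc v).mul_left
    · exact (hf.continuous.mul hφ.continuous).integrable_of_hasCompactSupport hφc.mul_left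

theorem memW1p_of_contDiff {f : EuclideanSpace ℝ (Fin d) → ℝ} (hf : ContDiff ℝ ∞ f)
    (hfc : HasCompactSupport f) : MemW1p p f := by
  refine ⟨hf.continuous.memLp_of_hasCompactSupport hfc, _, hasWeakGradient_of_contDiff hf, ?_⟩
  refine Continuous.memLp_of_hasCompactSupport ?_ ?_
  · exact (InnerProductSpace.toDual ℝ _).symm.continuous.comp (hf.continuous_fderiv (by simp))
  · exact (hfc.fderiv ℝ).comp_left (g := (InnerProductSpace.toDual ℝ _).symm) (map_zero _)

theorem exists_memW1p0_ball (hp : 1 < p) (c : EuclideanSpace ℝ (Fin d)) {r : ℝ} (hr : 0 < r) :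
    ∃ u : EuclideanSpace ℝ (Fin d) → ℝ, MemW1p p u ∧ (∀ x ∉ Metric.ball c r, u x = 0) ∧
      (∀ x, 0 ≤ u x) ∧ eLpNorm u (ENNReal.ofReal p) volume = 1 := by
  let f : ContDiffBump c := ⟨r / 2, r, half_pos hr, half_lt_self hr⟩
  have hm : MemLp f (ENNReal.ofReal p) volume :=
    f.continuous.memLp_of_hasCompactSupport f.hasCompactSupport
  have h0 : eLpNorm f (ENNReal.ofReal p) volume ≠ 0 := by
    rw [Ne, eLpNorm_eq_zero_iff hm.1 (ofReal_ne_zero_of_one_lt hp),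
      Continuous.ae_eq_iff_eq volume f.continuous continuous_zero]
    intro h
    have h1 := f.one_of_mem_closedBall (Metric.mem_closedBall_self (half_pos hr).le)
    rw [h] at h1
    exact zero_ne_one h1
  set a : ℝ := (eLpNorm f (ENNReal.ofReal p) volume).toReal⁻¹ with ha
  have ha0 : 0 ≤ a := inv_nonneg.2 ENNReal.toReal_nonneg
  refine ⟨a • f, memW1p_of_contDiff (contDiff_const.smul f.contDiff) ?_, fun x hx => ?_,
    fun x => mul_nonneg ha0 f.nonneg, ?_⟩
  · exact f.hasCompactSupport.smul_left (f := fun _ => a)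
  · have h1 : f x = 0 := f.zero_of_le_dist (not_lt.1 hx)
    simp [h1]
  · rw [eLpNorm_const_smul, ← ofReal_norm, Real.norm_of_nonneg ha0, ha,
      ENNReal.ofReal_inv_of_pos (ENNReal.toReal_pos h0 hm.2.ne), ENNReal.ofReal_toReal hm.2.ne,
      ENNReal.inv_mul_cancel h0 hm.2.ne]

theorem exists_disjoint_balls (hd : 1 ≤ d) (N : ℕ) {Ω : Set (EuclideanSpace ℝ (Fin d))}
    (hne : Ω.Nonempty) (hopen : IsOpen Ω) :
    ∃ (c : Fin N → EuclideanSpace ℝ (Fin d)) (r : ℝ), 0 < r ∧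
      (∀ i, Metric.ball (c i) r ⊆ Ω) ∧
      ∀ i j, i ≠ j → Disjoint (Metric.ball (c i) r) (Metric.ball (c j) r) := by
  obtain ⟨x₀, hx₀⟩ := hne
  obtain ⟨ρ, hρ, hball⟩ := Metric.isOpen_iff.1 hopen x₀ hx₀
  set e : EuclideanSpace ℝ (Fin d) := EuclideanSpace.single ⟨0, hd⟩ 1 with he
  have he1 : ‖e‖ = 1 := by simp [he]
  -- The centres lie on one segment at spacing `s`, so balls of radius `s / 2` are disjoint, and the
  -- farthest one stays within distance `ρ` of `x₀`.
  set s : ℝ := ρ / (N + 1) with hs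
  have hs0 : 0 < s := by positivity
  have hsN : s * (N + 1) = ρ := by rw [hs]; field_simp
  refine ⟨fun i => x₀ + ((i : ℝ) * s) • e, s / 2, half_pos hs0, fun i => ?_, fun i j hij => ?_⟩
  · refine (Metric.ball_subset_ball' ?_).trans hball
    rw [dist_eq_norm, add_sub_cancel_left, norm_smul, he1, mul_one,
      Real.norm_of_nonneg (by positivity)]
    have hi : (i : ℝ) + 1 ≤ N := by exact_mod_cast i.2
    nlinarith
  · apply Metric.ball_disjoint_ball
    rw [add_halves, dist_eq_norm, add_sub_add_left_eq_sub, ← sub_smul, norm_smul, he1, mul_one,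
      ← sub_mul, norm_mul, Real.norm_of_nonneg hs0.le]
    refine le_mul_of_one_le_left hs0.le ?_
    have h1 : (1 : ℤ) ≤ |((i : ℕ) : ℤ) - ((j : ℕ) : ℤ)| :=
      Int.one_le_abs (sub_ne_zero.2 fun h => hij (Fin.ext (by exact_mod_cast h)))
    rw [Real.norm_eq_abs]
    exact_mod_cast h1

theorem funEigenvalue_ne_top (hd : 1 ≤ d) (hp : 1 < p) (Φ : (Fin N → ℝ≥0) → ℝ≥0)
    {Ω : Set (EuclideanSpace ℝ (Fin d))} (hne : Ω.Nonempty) (hopen : IsOpen Ω) :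
    funEigenvalue p Φ Ω ≠ ⊤ := by
  obtain ⟨c, r, hr, hsub, hdisj⟩ := exists_disjoint_balls hd N hne hopen
  choose u hu hu0 hupos hu1 using fun i => exists_memW1p0_ball (p := p) hp (c i) hr
  have hPN : IsPNFunction p Ω u := by
    refine ⟨fun i => ⟨hu i, Eventually.of_forall fun x hx => hu0 i x fun h => hx (hsub i h)⟩,
      fun i => Eventually.of_forall (hupos i), hu1, fun i j hij => ?_⟩
    refine Eventually.of_forall fun x _ => ?_
    by_cases hx : x ∈ Metric.ball (c i) r
    · rw [hu0 j x (Set.disjoint_left.1 (hdisj i j hij) hx), mul_zero]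
    · rw [hu0 i x hx, zero_mul]
  exact ne_top_of_le_ne_top
    (evalRef_ne_top_iff.2 fun i => (hu i).lintegral_weakGrad_ne_top hp) (iInf₂_le u hPN)

/-! ### Comparison of the two eigenvalues and conclusion -/

theorem funEigenvalue_le_geomEigenvalue (hp : 1 < p) (Φ : (Fin N → ℝ≥0) → ℝ≥0)
    {Ω : Set (EuclideanSpace ℝ (Fin d))} (hbdd : Bornology.IsBounded Ω) :
    funEigenvalue p Φ Ω ≤ geomEigenvalue p Φ Ω := by
  refine le_iInf₂ fun E hE => ?_
  by_cases hfin : ∀ i, firstEigenvalue p (E i) ≠ ⊤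
  · obtain ⟨u, hu, hgrad, -⟩ := hE.exists_isPNFunction hp hbdd hfin
    rw [← hgrad]
    exact iInf₂_le u hu
  · rw [evalRef, if_neg hfin]
    exact le_top

theorem geomEigenvalue_le_funEigenvalue {Φ : (Fin N → ℝ≥0) → ℝ≥0} (hΦ : Monotone Φ)
    (Ω : Set (EuclideanSpace ℝ (Fin d))) : geomEigenvalue p Φ Ω ≤ funEigenvalue p Φ Ω :=
  le_iInf₂ fun _ hu => (iInf₂_le _ hu.isNSet).trans
    (evalRef_mono hΦ hu.firstEigenvalue_le_gradEnergy)

end NPartition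

theorem mainTheorem9 {d N : ℕ} (hd : 1 ≤ d) (hN : 1 ≤ N) (p : ℝ) (hp : 1 < p)
    (Φ : (Fin N → ℝ≥0) → ℝ≥0)
    (Ω : Set (EuclideanSpace ℝ (Fin d))) (hne : Ω.Nonempty) (hbdd : Bornology.IsBounded Ω)
    (hopen : IsOpen Ω) :
    NPartition.funEigenvalue p Φ Ω ≤ NPartition.geomEigenvalue p Φ Ω ∧
    (Monotone Φ →
      NPartition.geomEigenvalue p Φ Ω = NPartition.funEigenvalue p Φ Ω ∧
      (∀ u : Fin N → EuclideanSpace ℝ (Fin d) → ℝ, NPartition.IsEigenNFunction p Φ Ω u →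
        NPartition.IsEigenNSet p Φ Ω (fun i => {x | 0 < u i x})) ∧
      (∀ E : Fin N → Set (EuclideanSpace ℝ (Fin d)), NPartition.IsEigenNSet p Φ Ω E →
        ∃ u : Fin N → EuclideanSpace ℝ (Fin d) → ℝ, NPartition.IsEigenNFunction p Φ Ω u ∧
          ∀ i, volume ({x | 0 < u i x} \ E i) = 0)) := by
  have hle := NPartition.funEigenvalue_le_geomEigenvalue hp Φ hbdd
  refine ⟨hle, fun hΦ => ?_⟩
  have heq := le_antisymm (NPartition.geomEigenvalue_le_funEigenvalue hΦ Ω) hle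
  refine ⟨heq, fun u hu => ?_, fun E hE => ?_⟩
  · refine ⟨hu.1.isNSet, le_antisymm ?_ (iInf₂_le _ hu.1.isNSet)⟩
    rw [heq, ← hu.2]
    exact NPartition.evalRef_mono hΦ hu.1.firstEigenvalue_le_gradEnergy
  -- Finiteness of the attained value forces every chamber of `E` to have a finite eigenvalue, so
  -- eigenfunctions exist on all of them.
  · have hfin := NPartition.funEigenvalue_ne_top hd hp Φ hne hopen
    rw [← heq, ← hE.2, NPartition.evalRef_ne_top_iff] at hfin
    obtain ⟨u, hu, hgrad, hsub⟩ := hE.1.exists_isPNFunction hp hbdd hfin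
    exact ⟨u, ⟨hu, by rw [hgrad, hE.2, heq]⟩, hsub⟩
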